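/- Let $\mathbb T^2=(\mathbb R/2\pi\mathbb Z)^2$ and write $\hat f(k)=(2\pi)^{-2}\int_{\mathbb T^2}f(x)e^{-ik\cdot x}\,dx$, $k\in\mathbb Z^2$. All functions are real-valued with mean zero over $\mathbb T^2$. Consider the singular incompressible porous media equation $$\partial_t\theta+u\cdot\nabla\theta=0,\qquad u=(-\Delta)^{\alpha/2}\mathbf I\theta,\qquad \theta(\cdot,0)=\theta_0\qquad\text{on }\mathbb T^2,$$ where $\mathbf I=(\mathbf I_1,\mathbf I_2)$ is the Fourier multiplier with $\hat{\mathbf I}(k)=\big(-\tfrac{k_1k_2}{|k|^2},\tfrac{k_1^2}{|k|^2}\big)$ for $k\neq0$ and $\hat{\mathbf I}(0)=(0,0)$. For fixed $r>3$ and for $s,\tau>0$ let $G^s_\tau$ be the space of functions with $$\|f\|_{G^s_\tau}^2=\sum_{k\ne0}|k|^{2r}e^{2\tau|k|^{1/s}}|\hat f(k)|^2<\infty,$$ and let $\|f\|_{H^q}^2=\sum_k(1+|k|^2)^q|\hat f(k)|^2$. The equation is called locally Lipschitz $(H^q,G^s_\tau)$ well-posed if there are continuous functions $T,K:[0,\infty)^2\to(0,\infty)$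 such that for all $\theta_0^{(1)},\theta_0^{(2)}\in G^s_\tau$, with $T$ and $K$ evaluated at $(\|\theta_0^{(1)}\|_{G^s_\tau},\|\theta_0^{(2)}\|_{G^s_\tau})$, there exist unique weak solutions $\theta^{(1)},\theta^{(2)}\in L^\infty(0,T;H^q)$ with these initial data (each taken as its representative in $C([0,T];L^2)$), and $$\|\theta^{(1)}(t)-\theta^{(2)}(t)\|_{H^q}\le K\,\|\theta_0^{(1)}-\theta_0^{(2)}\|_{G^s_\tau}\qquad\text{for every }t\in[0,T].$$ Otherwise it is called locally Lipschitz $(H^q,G^s_\tau)$ ill-posed. **Theorem.** Let $\alpha\in[1,2)$, $q>\alpha+\tfrac12$, $s>\tfrac1\alpha$ and $r>3$. Then for every $\tau>0$ the singular incompressible porous media equation above is locally Lipschitz $(H^q,G^s_\tau)$ ill-posed. -/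

import Mathlib

open scoped ENNReal NNReal ContDiff

noncomputable section

namespace SIPM

instance instTwoPiPos : Fact (0 < 2 * Real.pi) := ⟨Real.two_pi_pos⟩

/-- The torus `𝕋² = (ℝ / 2πℤ)²`, with its Lebesgue measure (of total mass `(2π)²`). -/
abbrev Torus : Type := Fin 2 → AddCircle (2 * Real.pi)

/-- The real Hilbert space `L²(𝕋²; ℝ)`. -/
abbrev L2 : Type := MeasureTheory.Lp ℝ 2 (MeasureTheory.volume : MeasureTheory.Measure Torus)

/-- The character `x ↦ exp (i k · x)` of the torus. -/
def character (k : Fin 2 → ℤ) (x : Torus) : ℂ := ∏ i, fourier (k i) (x i)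

/-- The Fourier coefficient `(2π)⁻² ∫ f(x) exp (-i k · x) dx`. -/
def coeff (f : L2) (k : Fin 2 → ℤ) : ℂ :=
  ((2 * Real.pi : ℝ) : ℂ)⁻¹ ^ 2 * ∫ x : Torus, (f x : ℂ) * character (-k) x

/-- The Euclidean length `|k|` of a frequency `k ∈ ℤ²`. -/
def freqNorm (k : Fin 2 → ℤ) : ℝ := Real.sqrt ((k 0 : ℝ) ^ 2 + (k 1 : ℝ) ^ 2)

/-- `f` has mean zero. -/
def MeanFree (f : L2) : Prop := ∫ x : Torus, f x = 0

/-- The inhomogeneous Sobolev norm of `H^q(𝕋²)`; its value is `∞` exactly when `f ∉ H^q`. -/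
def sobolevNorm (q : ℝ) (f : L2) : ℝ≥0∞ :=
  (∑' k : Fin 2 → ℤ, ENNReal.ofReal ((1 + freqNorm k ^ 2) ^ q * ‖coeff f k‖ ^ 2)) ^ (1 / 2 : ℝ)

/-- The Gevrey norm `‖(-Δ)^{r/2} exp (τ (-Δ)^{1/(2s)}) f‖_{L²}`, a sum over nonzero frequencies;
its value is `∞` exactly when a mean-free `f` does not lie in `G^s_τ`. -/
def gevreyNorm (r s τ : ℝ) (f : L2) : ℝ≥0∞ :=
  (∑' k : {k : Fin 2 → ℤ // k ≠ 0},
    ENNReal.ofReal (freqNorm k ^ (2 * r) * Real.exp (2 * τ * freqNorm k ^ (1 / s))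
      * ‖coeff f k‖ ^ 2)) ^ (1 / 2 : ℝ)

/-- `f` belongs to the space `G^s_τ` of mean-free functions with finite Gevrey norm. -/
def MemGevrey (r s τ : ℝ) (f : L2) : Prop := MeanFree f ∧ gevreyNorm r s τ f < ⊤

/-- `g = m(D) f`: both are in `L²` and `ĝ(k) = m(k) f̂(k)` for every frequency `k`. -/
def IsMultiplierImage (m : (Fin 2 → ℤ) → ℂ) (f g : L2) : Prop :=
  ∀ k, coeff g k = m k * coeff f k

/-- The symbol `(-k₁k₂ / |k|², k₁² / |k|²)` of the operator `I`; at `k = 0` it is `(0, 0)`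
(division by zero gives zero). -/
def symbolI (k : Fin 2 → ℤ) : Fin 2 → ℝ :=
  ![-((k 0 : ℝ) * (k 1 : ℝ)) / ((k 0 : ℝ) ^ 2 + (k 1 : ℝ) ^ 2),
    (k 0 : ℝ) ^ 2 / ((k 0 : ℝ) ^ 2 + (k 1 : ℝ) ^ 2)]

/-- `u = (-Δ)^{α/2} I θ`. -/
def IsVelocity (α : ℝ) (θ : L2) (u : Fin 2 → L2) : Prop :=
  ∀ i, IsMultiplierImage (fun k => ((freqNorm k ^ α * symbolI k i : ℝ) : ℂ)) θ (u i)

/-- `g = ∇θ`, as a Fourier multiplier. -/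
def IsGradient (θ : L2) (g : Fin 2 → L2) : Prop :=
  ∀ i, IsMultiplierImage (fun k => Complex.I * (k i : ℂ)) θ (g i)

/-- `φ` is a smooth function on the torus, i.e. its periodic lift to `ℝ²` is smooth. -/
def SmoothOnTorus (φ : Torus → ℝ) : Prop :=
  ContDiff ℝ ∞ fun x : Fin 2 → ℝ => φ fun i => (x i : AddCircle (2 * Real.pi))

/-- `θ` is a (mean-free) solution on `[0, T]`, in the class `L^∞(0, T; H^q)`, of
`∂ₜθ + u · ∇θ = 0`, `u = (-Δ)^{α/2} I θ`, `θ(0) = θ₀`.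

The equation is understood weakly (tested against smooth functions of `x`, integrated in time).
For such `θ` the time derivative is bounded with values in `L²`, so that `θ` has a representative
that is continuous in time with values in `L²`, and for this representative the essential bound
of the `H^q` norm holds at every time; `θ` always denotes this representative. -/
structure IsSolution (α q T : ℝ) (θ₀ : L2) (θ : ℝ → L2) : Prop where
  continuousOn : ContinuousOn θ (Set.Icc 0 T)
  bounded : ∃ M : ℝ≥0, ∀ t ∈ Set.Icc 0 T, sobolevNorm q (θ t) ≤ M
  meanFree : ∀ t ∈ Set.Icc 0 T, MeanFree (θ t)
  initial : θ 0 = θ₀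
  equation : ∃ u g : ℝ → Fin 2 → L2,
    (∀ t ∈ Set.Icc 0 T, IsVelocity α (θ t) (u t) ∧ IsGradient (θ t) (g t)) ∧
    ∀ φ : Torus → ℝ, SmoothOnTorus φ → ∀ t ∈ Set.Icc 0 T,
      (∫ x : Torus, θ t x * φ x) - (∫ x : Torus, θ₀ x * φ x)
        = -∫ t' in (0 : ℝ)..t, ∫ x : Torus, (∑ i, u t' i x * g t' i x) * φ x

/-- `θ` is the only solution on `[0, T]` in the class `L^∞(0, T; H^q)` with data `θ₀`. -/
def IsUniqueSolution (α q T : ℝ) (θ₀ : L2) (θ : ℝ → L2) : Prop :=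
  IsSolution α q T θ₀ θ ∧
    ∀ θ' : ℝ → L2, IsSolution α q T θ₀ θ' → Set.EqOn θ' θ (Set.Icc 0 T)

/-- Local Lipschitz `(H^q, G^s_τ)` well-posedness: there are continuous functions
`T, K : [0, ∞)² → (0, ∞)` such that any two data in `G^s_τ` launch unique solutions in
`L^∞(0, T; H^q)`, and `‖θ₁(t) - θ₂(t)‖_{H^q} ≤ K ‖θ₁(0) - θ₂(0)‖_{G^s_τ}` on `[0, T]`, where `T`
and `K` are evaluated at the Gevrey norms of the two data. -/
def LocallyLipschitzWellPosed (α q r s τ : ℝ) : Prop :=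
  ∃ T K : ℝ≥0 × ℝ≥0 → ℝ, Continuous T ∧ Continuous K ∧ (∀ p, 0 < T p) ∧ (∀ p, 0 < K p) ∧
    ∀ θ₀₁ θ₀₂ : L2, MemGevrey r s τ θ₀₁ → MemGevrey r s τ θ₀₂ →
      let p : ℝ≥0 × ℝ≥0 := ((gevreyNorm r s τ θ₀₁).toNNReal, (gevreyNorm r s τ θ₀₂).toNNReal)
      ∃ θ₁ θ₂ : ℝ → L2,
        IsUniqueSolution α q (T p) θ₀₁ θ₁ ∧ IsUniqueSolution α q (T p) θ₀₂ θ₂ ∧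
        ∀ t ∈ Set.Icc 0 (T p),
          sobolevNorm q (θ₁ t - θ₂ t) ≤ ENNReal.ofReal (K p) * gevreyNorm r s τ (θ₀₁ - θ₀₂)

/-- Local Lipschitz `(H^q, G^s_τ)` ill-posedness is the failure of well-posedness. -/
def LocallyLipschitzIllPosed (α q r s τ : ℝ) : Prop := ¬ LocallyLipschitzWellPosed α q r s τ

end SIPM

end

/-!
The shear flow `-2 sin x₂` is stationary with zero velocity. For a solution `θ = -2 sin x₂ + ρ`, the
real parts `z_j` of the Fourier coefficients of `ρ` at `k = (n, j)`, `j ∈ ℤ`, satisfy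
`z_j' = σ_{j-1} z_{j-1} + σ_{j+1} z_{j+1} + O(‖ρ‖²)` with the nonnegative rates
`σ_j = |k|^α n² / |k|²`, which are at most `n²` and, for `|j| ≤ 1`, at least `n^α / 2`. Since the
coupling is nonnegative, comparison with the two-site system on `j ∈ {0, 1}` shows that an initial
perturbation `ρ = 2 ε cos (n x₁)` grows to size at least `ε cosh (n^α T / 2) - O(ε²)` at time `T`.
A Lipschitz estimate would bound this by `2 ε K n^r exp (τ n^{1/s})` with `T` and `K` independent of
`ε` and `n`. Letting `ε → 0` gives `cosh (n^α T / 2) ≤ 2 K n^r exp (τ n^{1/s})` for every `n ≥ 1`,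
which fails for large `n` because `1/s < α`.
-/

noncomputable section

namespace SIPM

open MeasureTheory Set Filter Topology Asymptotics
open scoped ComplexConjugate

lemma character_neg (k : Fin 2 → ℤ) (x : Torus) : character (-k) x = conj (character k x) := by
  simp only [character, Pi.neg_apply, fourier_neg, map_prod]

lemma character_add (k l : Fin 2 → ℤ) (x : Torus) :
    character (k + l) x = character k x * character l x := by
  simp only [character, Pi.add_apply, fourier_add, ← Finset.prod_mul_distrib]

lemma character_zero (x : Torus) : character 0 x = 1 := by
  simp [character]

lemma norm_character (k : Fin 2 → ℤ) (x : Torus) : ‖character k x‖ = 1 := by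
  simp [character, fourier_apply, Circle.norm_coe]

lemma continuous_character (k : Fin 2 → ℤ) : Continuous (character k) := by
  unfold character
  fun_prop

/-- The Haar probability measure on the torus with periods `1`, for which the library proves
Parseval's identity. -/
def unitTorusMeasure : Measure (UnitAddTorus (Fin 2)) := Measure.pi fun _ => AddCircle.haarAddCircle

/-- The dilation by `2π` from the torus with periods `1` to the torus with periods `2π`. -/
def dilation : UnitAddTorus (Fin 2) ≃ₜ Torus :=
  Homeomorph.piCongrRight fun _ =>
    AddCircle.homeomorphAddCircle 1 (2 * Real.pi) one_ne_zero Real.two_pi_pos.ne'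

lemma fourier_homeomorphAddCircle {p p' : ℝ} (hp : p ≠ 0) (hp' : p' ≠ 0) (n : ℤ)
    (x : AddCircle p) :
    fourier n (AddCircle.homeomorphAddCircle p p' hp hp' x) = fourier n x := by
  induction x using QuotientAddGroup.induction_on with | _ x
  have hp_complex : (p : ℂ) ≠ 0 := Complex.ofReal_ne_zero.mpr hp
  have hp'_complex : (p' : ℂ) ≠ 0 := Complex.ofReal_ne_zero.mpr hp'
  rw [AddCircle.homeomorphAddCircle_apply_mk, fourier_coe_apply, fourier_coe_apply]
  congr 1
  push_cast
  field_simp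

lemma character_dilation (k : Fin 2 → ℤ) (y : UnitAddTorus (Fin 2)) :
    character k (dilation y) = UnitAddTorus.mFourier k y :=
  Fintype.prod_congr (fun i => fourier (k i) (dilation y i)) _ fun i =>
    fourier_homeomorphAddCircle one_ne_zero Real.two_pi_pos.ne' (k i) (y i)

lemma volume_univ_torus : volume (univ : Set Torus) = ENNReal.ofReal ((2 * Real.pi) ^ 2) := by
  rw [volume_pi, Measure.pi_univ, Fin.prod_univ_two, AddCircle.measure_univ, sq,
    ENNReal.ofReal_mul Real.two_pi_pos.le]

lemma measurePreserving_dilation :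
    MeasurePreserving dilation unitTorusMeasure
      (ENNReal.ofReal ((2 * Real.pi) ^ 2)⁻¹ • (volume : Measure Torus)) := by
  have hc : ENNReal.ofReal ((2 * Real.pi) ^ 2)⁻¹ ≠ 0 :=
    (ENNReal.ofReal_pos.mpr (by positivity)).ne'
  have := Measure.IsAddHaarMeasure.smul (volume : Measure Torus) hc ENNReal.ofReal_ne_top
  have : unitTorusMeasure.IsAddHaarMeasure := by unfold unitTorusMeasure; infer_instance
  refine AddMonoidHom.measurePreserving (f := (AddEquiv.piCongrRight fun _ =>
    AddCircle.equivAddCircle 1 (2 * Real.pi) one_ne_zero Real.two_pi_pos.ne').toAddMonoidHom)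
    dilation.continuous dilation.surjective ?_
  rw [Measure.smul_apply, volume_univ_torus, smul_eq_mul, ← ENNReal.ofReal_mul (by positivity),
    inv_mul_cancel₀ (by positivity), unitTorusMeasure, Measure.pi_univ]
  simp

lemma integral_comp_dilation {E : Type*} [NormedAddCommGroup E] [NormedSpace ℝ E] (F : Torus → E) :
    ∫ y, F (dilation y) ∂unitTorusMeasure = ((2 * Real.pi) ^ 2)⁻¹ • ∫ x, F x := by
  rw [measurePreserving_dilation.integral_comp dilation.measurableEmbedding,
    integral_smul_measure, ENNReal.toReal_ofReal (by positivity)]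

lemma integral_character (k : Fin 2 → ℤ) :
    ∫ x : Torus, character k x = if k = 0 then ((2 * Real.pi : ℝ) : ℂ) ^ 2 else 0 := by
  have horth := (orthonormal_iff_ite.mp (UnitAddTorus.orthonormal_mFourier (d := Fin 2))) 0 k
  rw [UnitAddTorus.mFourierLp, ContinuousMap.inner_toLp] at horth
  have hunit : ∫ y, character k (dilation y) ∂unitTorusMeasure = if k = 0 then 1 else 0 := by
    simp only [character_dilation, eq_comm (a := k)]
    rw [← horth]
    simp only [UnitAddTorus.mFourier_zero, ContinuousMap.one_apply, map_one, mul_one]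
    rfl
  have hpi : ((2 * Real.pi : ℝ) : ℂ) ≠ 0 := Complex.ofReal_ne_zero.mpr Real.two_pi_pos.ne'
  rw [integral_comp_dilation, Complex.real_smul, Complex.ofReal_inv, Complex.ofReal_pow,
    inv_mul_eq_iff_eq_mul₀ (pow_ne_zero 2 hpi)] at hunit
  rw [hunit, mul_ite, mul_one, mul_zero]

lemma integral_sq_eq_norm_sq (f : L2) : ∫ x, ‖f x‖ ^ 2 = ‖f‖ ^ 2 := by
  rw [← real_inner_self_eq_norm_sq, L2.inner_def]
  simp only [real_inner_self_eq_norm_sq]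

lemma hasSum_sq_norm_coeff (f : L2) :
    HasSum (fun k => ‖coeff f k‖ ^ 2) (((2 * Real.pi) ^ 2)⁻¹ * ‖f‖ ^ 2) := by
  have hmem : MemLp (fun y => (f (dilation y) : ℂ)) 2 unitTorusMeasure :=
    (((Lp.memLp f).smul_measure ENNReal.ofReal_ne_top).comp_measurePreserving
      measurePreserving_dilation).ofReal
  have hae : hmem.toLp _ =ᵐ[unitTorusMeasure] fun y => (f (dilation y) : ℂ) := hmem.coeFn_toLp
  have hnorm : ∫ y, ‖hmem.toLp _ y‖ ^ 2 ∂unitTorusMeasure = ((2 * Real.pi) ^ 2)⁻¹ * ‖f‖ ^ 2 := by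
    rw [← integral_sq_eq_norm_sq, ← smul_eq_mul (_⁻¹), ← integral_comp_dilation]
    refine integral_congr_ae ?_
    filter_upwards [hae] with y hy
    rw [hy, Complex.norm_real]
  have hcoeff (k : Fin 2 → ℤ) : UnitAddTorus.mFourierCoeff (hmem.toLp _) k = coeff f k := by
    have hdilate := integral_comp_dilation fun x => (f x : ℂ) * character (-k) x
    rw [Complex.real_smul, Complex.ofReal_inv, Complex.ofReal_pow, ← inv_pow] at hdilate
    rw [coeff, ← hdilate]
    refine integral_congr_ae ?_
    filter_upwards [hae] with y hy
    rw [hy, character_dilation, smul_eq_mul, mul_comm]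
  rw [← hnorm]
  simp only [← hcoeff]
  exact UnitAddTorus.hasSum_sq_mFourierCoeff (hmem.toLp _)

lemma integrable_mul_character (f : L2) (k : Fin 2 → ℤ) :
    Integrable (fun x : Torus => (f x : ℂ) * character k x) :=
  ((Lp.memLp f).integrable one_le_two).ofReal.mul_bdd (continuous_character k).aestronglyMeasurable
    (ae_of_all _ fun x => (norm_character k x).le)

lemma coeff_sub (f g : L2) (k : Fin 2 → ℤ) : coeff (f - g) k = coeff f k - coeff g k := by
  rw [coeff, coeff, coeff, ← mul_sub,
    ← integral_sub (integrable_mul_character f _) (integrable_mul_character g _)]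
  congr 1
  refine integral_congr_ae ?_
  filter_upwards [Lp.coeFn_sub f g] with x hx
  rw [hx, Pi.sub_apply, Complex.ofReal_sub, sub_mul]

lemma coeff_zero (k : Fin 2 → ℤ) : coeff 0 k = 0 := by
  simpa using coeff_sub 0 0 k

lemma coeff_neg (f : L2) (k : Fin 2 → ℤ) : coeff (-f) k = -coeff f k := by
  simpa [coeff_zero] using coeff_sub 0 f k

lemma coeff_add (f g : L2) (k : Fin 2 → ℤ) : coeff (f + g) k = coeff f k + coeff g k := by
  simpa [coeff_neg] using coeff_sub f (-g) k

lemma meanFree_iff_coeff_zero {f : L2} : MeanFree f ↔ coeff f 0 = 0 := by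
  simp [MeanFree, coeff, neg_zero, character_zero, integral_complex_ofReal,
    Real.pi_ne_zero]

/-- The `ℓ²` norm of the Fourier coefficients with weights `w`. -/
def weightedNorm (w : (Fin 2 → ℤ) → ℝ) (f : L2) : ℝ≥0∞ :=
  eLpNorm (fun k => (w k : ℂ) * coeff f k) 2 Measure.count

/-- The weight of the Sobolev space `H^q`. -/
def sobolevWeight (q : ℝ) (k : Fin 2 → ℤ) : ℝ := (1 + freqNorm k ^ 2) ^ (q / 2)

/-- The weight of the Gevrey space `G^s_τ`, which ignores the zero frequency. -/
def gevreyWeight (r s τ : ℝ) (k : Fin 2 → ℤ) : ℝ :=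
  if k = 0 then 0 else freqNorm k ^ r * Real.exp (τ * freqNorm k ^ (1 / s))

lemma weightedNorm_eq_tsum (w : (Fin 2 → ℤ) → ℝ) (f : L2) :
    weightedNorm w f = (∑' k, ENNReal.ofReal (w k ^ 2 * ‖coeff f k‖ ^ 2)) ^ (1 / 2 : ℝ) := by
  rw [weightedNorm, eLpNorm_eq_lintegral_rpow_enorm_toReal two_ne_zero ENNReal.ofNat_ne_top,
    lintegral_count, ENNReal.toReal_ofNat]
  congr 2 with k
  rw [← ofReal_norm, ENNReal.rpow_ofNat, ← ENNReal.ofReal_pow (norm_nonneg _), norm_mul,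
    Complex.norm_real, mul_pow, Real.norm_eq_abs, sq_abs]

lemma freqNorm_nonneg (k : Fin 2 → ℤ) : 0 ≤ freqNorm k := Real.sqrt_nonneg _

lemma sq_freqNorm (k : Fin 2 → ℤ) : freqNorm k ^ 2 = (k 0 : ℝ) ^ 2 + (k 1 : ℝ) ^ 2 :=
  Real.sq_sqrt (by positivity)

lemma one_le_one_add_sq_freqNorm (k : Fin 2 → ℤ) : 1 ≤ 1 + freqNorm k ^ 2 :=
  le_add_of_nonneg_right (sq_nonneg _)

lemma sobolevNorm_eq_weightedNorm (q : ℝ) (f : L2) :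
    sobolevNorm q f = weightedNorm (sobolevWeight q) f := by
  rw [weightedNorm_eq_tsum, sobolevNorm]
  congr 2 with k
  rw [sobolevWeight, ← Real.rpow_mul_natCast (by positivity), Nat.cast_ofNat,
    div_mul_cancel₀ _ two_ne_zero]

lemma gevreyNorm_eq_weightedNorm (r s τ : ℝ) (f : L2) :
    gevreyNorm r s τ f = weightedNorm (gevreyWeight r s τ) f := by
  rw [weightedNorm_eq_tsum, gevreyNorm]
  refine congrArg (· ^ (1 / 2 : ℝ)) ((tsum_subtype {k : Fin 2 → ℤ | k ≠ 0} fun k =>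
    ENNReal.ofReal (freqNorm k ^ (2 * r) * Real.exp (2 * τ * freqNorm k ^ (1 / s))
      * ‖coeff f k‖ ^ 2)).trans (tsum_congr fun k => ?_))
  by_cases hk : k = 0
  · simp [gevreyWeight, hk]
  · rw [indicator_of_mem (by exact hk), gevreyWeight, if_neg hk, mul_pow,
      ← Real.rpow_mul_natCast (freqNorm_nonneg _), ← Real.exp_nat_mul, Nat.cast_ofNat, mul_comm r,
      mul_assoc 2 τ]

lemma enorm_eq_weightedNorm (f : L2) :
    ‖f‖ₑ = ENNReal.ofReal (2 * Real.pi) * weightedNorm 1 f := by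
  have hsum := hasSum_sq_norm_coeff f
  rw [weightedNorm_eq_tsum]
  simp only [Pi.one_apply, one_pow, one_mul]
  rw [← ENNReal.ofReal_tsum_of_nonneg (fun k => sq_nonneg _) hsum.summable, hsum.tsum_eq,
    ENNReal.ofReal_rpow_of_nonneg (by positivity) (by norm_num), ← Real.sqrt_eq_rpow,
    ← inv_pow, ← mul_pow, Real.sqrt_sq (by positivity),
    ← ENNReal.ofReal_mul Real.two_pi_pos.le, mul_inv_cancel_left₀ Real.two_pi_pos.ne', ofReal_norm]

lemma weightedNorm_add_le (w : (Fin 2 → ℤ) → ℝ) (f g : L2) :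
    weightedNorm w (f + g) ≤ weightedNorm w f + weightedNorm w g := by
  simp only [weightedNorm, coeff_add, mul_add]
  exact eLpNorm_add_le .of_discrete .of_discrete one_le_two

lemma weightedNorm_sub_le (w : (Fin 2 → ℤ) → ℝ) (f g : L2) :
    weightedNorm w (f - g) ≤ weightedNorm w f + weightedNorm w g := by
  simp only [weightedNorm, coeff_sub, mul_sub]
  exact eLpNorm_sub_le .of_discrete .of_discrete one_le_two

lemma enorm_mul_coeff_le_weightedNorm (w : (Fin 2 → ℤ) → ℝ) (f : L2) (k : Fin 2 → ℤ) :
    ‖(w k : ℂ) * coeff f k‖ₑ ≤ weightedNorm w f :=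
  enorm_le_eLpNorm_count (fun k => (w k : ℂ) * coeff f k) k two_ne_zero

lemma one_le_sobolevWeight {q : ℝ} (hq : 0 ≤ q) (k : Fin 2 → ℤ) : 1 ≤ sobolevWeight q k :=
  Real.one_le_rpow (one_le_one_add_sq_freqNorm k) (by positivity)

lemma norm_coeff_le_of_sobolevNorm_le {q : ℝ} {M : ℝ≥0} (hq : 0 ≤ q) {f : L2}
    (h : sobolevNorm q f ≤ M) (k : Fin 2 → ℤ) : ‖coeff f k‖ ≤ M := by
  have hk : ‖(sobolevWeight q k : ℂ) * coeff f k‖ₑ ≤ M := by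
    rw [sobolevNorm_eq_weightedNorm] at h
    exact (enorm_mul_coeff_le_weightedNorm _ f k).trans h
  have hk_real : ‖(sobolevWeight q k : ℂ) * coeff f k‖ ≤ M := by
    exact_mod_cast (ENNReal.coe_le_coe.mp hk : ‖(sobolevWeight q k : ℂ) * coeff f k‖₊ ≤ M)
  rw [norm_mul, Complex.norm_real] at hk_real
  exact (le_mul_of_one_le_left (norm_nonneg _)
    ((one_le_sobolevWeight hq k).trans (le_abs_self _))).trans hk_real

lemma IsMultiplierImage.sub {f g f' g' : L2} {m : (Fin 2 → ℤ) → ℂ}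
    (h : IsMultiplierImage m f g) (h' : IsMultiplierImage m f' g') :
    IsMultiplierImage m (f - f') (g - g') := fun k => by
  rw [coeff_sub, coeff_sub, h k, h' k, mul_sub]

lemma IsMultiplierImage.enorm_le {m : (Fin 2 → ℤ) → ℂ} {w : (Fin 2 → ℤ) → ℝ} {f g : L2}
    {δ C : ℝ} (h : IsMultiplierImage m f g) (hm : ∀ k, ‖m k‖ ≤ δ * w k + C) :
    ‖g‖ₑ ≤ ENNReal.ofReal (2 * Real.pi) * (‖δ‖ₑ * weightedNorm w f) + ‖C‖ₑ * ‖f‖ₑ := by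
  have hcoeff : weightedNorm 1 g ≤ ‖δ‖ₑ * weightedNorm w f + ‖C‖ₑ * weightedNorm 1 f := by
    calc weightedNorm 1 g
        ≤ eLpNorm ((δ • fun k => (w k : ℂ) * coeff f k) + C • fun k => (1 : ℂ) * coeff f k) 2
            Measure.count := by
          refine eLpNorm_mono fun k => ?_
          have hfactor : (δ • fun k => (w k : ℂ) * coeff f k) k + (C • fun k => 1 * coeff f k) k
              = ((δ * w k + C : ℝ) : ℂ) * coeff f k := by
            simp only [Pi.smul_apply, Complex.real_smul]
            push_cast
            ring
          rw [Pi.add_apply, hfactor, Pi.one_apply, Complex.ofReal_one, one_mul, h k, norm_mul,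
            norm_mul, Complex.norm_real]
          gcongr
          exact (hm k).trans (le_abs_self _)
      _ ≤ ‖δ‖ₑ * weightedNorm w f + ‖C‖ₑ * weightedNorm 1 f := by
          refine (eLpNorm_add_le .of_discrete .of_discrete one_le_two).trans ?_
          rw [eLpNorm_const_smul, eLpNorm_const_smul]
          simp [weightedNorm]
  rw [enorm_eq_weightedNorm g, enorm_eq_weightedNorm f, mul_left_comm ‖C‖ₑ, ← mul_add]
  gcongr

lemma IsMultiplierImage.norm_le {m : (Fin 2 → ℤ) → ℂ} {w : (Fin 2 → ℤ) → ℝ} {f g : L2}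
    {δ C : ℝ} {M : ℝ≥0} (h : IsMultiplierImage m f g) (hm : ∀ k, ‖m k‖ ≤ δ * w k + C)
    (hf : weightedNorm w f ≤ M) : ‖g‖ ≤ 2 * Real.pi * (|δ| * M) + |C| * ‖f‖ := by
  have hle : ‖g‖ₑ ≤ ENNReal.ofReal (2 * Real.pi) * (‖δ‖ₑ * M) + ‖C‖ₑ * ‖f‖ₑ :=
    (h.enorm_le hm).trans (by gcongr)
  have hle_nnreal : ‖g‖₊ ≤ (2 * Real.pi).toNNReal * (‖δ‖₊ * M) + ‖C‖₊ * ‖f‖₊ := by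
    simp only [enorm_eq_nnnorm, ENNReal.ofReal] at hle
    exact_mod_cast hle
  simpa [Real.two_pi_pos.le, Real.pi_pos.le] using NNReal.coe_le_coe.mpr hle_nnreal

lemma tendsto_of_isMultiplierImage {X : Type*} {l : Filter X} {m : (Fin 2 → ℤ) → ℂ}
    {w : (Fin 2 → ℤ) → ℝ} {f g : X → L2} {f₀ g₀ : L2} {M : ℝ≥0}
    (hm : ∀ δ > 0, ∃ C, ∀ k, ‖m k‖ ≤ δ * w k + C)
    (hg : ∀ᶠ t in l, IsMultiplierImage m (f t) (g t)) (hg₀ : IsMultiplierImage m f₀ g₀)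
    (hM : ∀ᶠ t in l, weightedNorm w (f t - f₀) ≤ M) (hf : Tendsto f l (𝓝 f₀)) :
    Tendsto g l (𝓝 g₀) := by
  rw [Metric.tendsto_nhds]
  intro η hη
  have hδ : 0 < η / (4 * Real.pi * (M + 1)) := by positivity
  obtain ⟨C, hC⟩ := hm _ hδ
  have hsmall : Tendsto (fun t => |C| * ‖f t - f₀‖) l (𝓝 0) := by
    simpa using (tendsto_iff_norm_sub_tendsto_zero.mp hf).const_mul |C|
  filter_upwards [hg, hM, hsmall.eventually_lt_const (half_pos hη)] with t hgt hMt hlow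
  have hbound := (hgt.sub hg₀).norm_le hC hMt
  rw [abs_of_pos hδ] at hbound
  have hhigh : 2 * Real.pi * (η / (4 * Real.pi * (M + 1)) * M) ≤ η / 2 := by
    have hM_le : (M : ℝ) / (M + 1) ≤ 1 := div_le_one_of_le₀ (by linarith) (by positivity)
    calc 2 * Real.pi * (η / (4 * Real.pi * (M + 1)) * M) = η / 2 * (M / (M + 1)) := by
          field_simp; norm_num
      _ ≤ η / 2 := mul_le_of_le_one_right (by positivity) hM_le
  rw [dist_eq_norm]
  linarith

lemma continuousOn_of_isMultiplierImage {X : Type*} [TopologicalSpace X] {S : Set X}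
    {m : (Fin 2 → ℤ) → ℂ} {w : (Fin 2 → ℤ) → ℝ} {f g : X → L2} {M : ℝ≥0}
    (hm : ∀ δ > 0, ∃ C, ∀ k, ‖m k‖ ≤ δ * w k + C)
    (hg : ∀ t ∈ S, IsMultiplierImage m (f t) (g t))
    (hM : ∀ t ∈ S, weightedNorm w (f t) ≤ M) (hf : ContinuousOn f S) : ContinuousOn g S := by
  intro t₀ ht₀
  refine tendsto_of_isMultiplierImage (M := M + M) hm (eventually_mem_nhdsWithin.mono hg)
    (hg t₀ ht₀) (eventually_mem_nhdsWithin.mono fun t ht => ?_) (hf t₀ ht₀)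
  rw [ENNReal.coe_add]
  exact (weightedNorm_sub_le _ _ _).trans (add_le_add (hM t ht) (hM t₀ ht₀))

lemma isLittleO_rpow_rpow_atTop {a b : ℝ} (hab : a < b) :
    (fun x : ℝ => x ^ a) =o[atTop] fun x => x ^ b := by
  have hlim : Tendsto (fun x : ℝ => x ^ a / x ^ b) atTop (𝓝 0) := by
    refine (tendsto_rpow_neg_atTop (sub_pos.mpr hab)).congr' ?_
    filter_upwards [eventually_gt_atTop 0] with x hx
    rw [neg_sub, Real.rpow_sub hx]
  exact (isLittleO_iff_tendsto' <| (eventually_gt_atTop 0).mono fun x hx h =>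
    absurd h (Real.rpow_pos_of_pos hx b).ne').mpr hlim

lemma exists_rpow_le_mul_rpow_add {a b δ : ℝ} (ha : 0 ≤ a) (hab : a < b) (hδ : 0 < δ) :
    ∃ C : ℝ, ∀ x : ℝ, 1 ≤ x → x ^ a ≤ δ * x ^ b + C := by
  obtain ⟨N, hN⟩ := eventually_atTop.mp ((isLittleO_rpow_rpow_atTop hab).def hδ)
  refine ⟨|N| ^ a, fun x hx => ?_⟩
  have hx0 : 0 ≤ x := zero_le_one.trans hx
  rcases le_total N x with h | h
  · have hxb : x ^ a ≤ δ * x ^ b := by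
      simpa only [Real.norm_of_nonneg (Real.rpow_nonneg hx0 _)] using hN x h
    exact hxb.trans (le_add_of_nonneg_right (by positivity))
  · have hxa : x ^ a ≤ |N| ^ a := Real.rpow_le_rpow hx0 (h.trans (le_abs_self N)) ha
    exact hxa.trans (le_add_of_nonneg_left (by positivity))

lemma exists_le_mul_sobolevWeight_add {a b : ℝ} {m : (Fin 2 → ℤ) → ℂ} (ha : 0 ≤ a) (hab : a < b)
    (hm : ∀ k, ‖m k‖ ≤ sobolevWeight a k) :
    ∀ δ > 0, ∃ C, ∀ k, ‖m k‖ ≤ δ * sobolevWeight b k + C := by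
  intro δ hδ
  obtain ⟨C, hC⟩ := exists_rpow_le_mul_rpow_add (div_nonneg ha zero_le_two)
    (div_lt_div_of_pos_right hab two_pos) hδ
  exact ⟨C, fun k => (hm k).trans (hC _ (one_le_one_add_sq_freqNorm k))⟩

lemma sobolevWeight_mono {a b : ℝ} (hab : a ≤ b) (k : Fin 2 → ℤ) :
    sobolevWeight a k ≤ sobolevWeight b k :=
  Real.rpow_le_rpow_of_exponent_le (one_le_one_add_sq_freqNorm k) (by linarith)

lemma freqNorm_rpow_le_sobolevWeight {a : ℝ} (ha : 0 ≤ a) (k : Fin 2 → ℤ) :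
    freqNorm k ^ a ≤ sobolevWeight a k := by
  rw [sobolevWeight, ← mul_div_cancel₀ a two_ne_zero, Real.rpow_mul (freqNorm_nonneg k),
    Real.rpow_two, mul_div_cancel₀ a two_ne_zero]
  exact Real.rpow_le_rpow (sq_nonneg _) (by linarith) (by positivity)

/-- The symbol of the `i`-th component `(-Δ)^{α/2} I_i` of the velocity. -/
def velocitySymbol (α : ℝ) (i : Fin 2) (k : Fin 2 → ℤ) : ℝ := freqNorm k ^ α * symbolI k i

lemma abs_symbolI_le_one (k : Fin 2 → ℤ) (i : Fin 2) : |symbolI k i| ≤ 1 := by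
  have hden : 0 ≤ (k 0 : ℝ) ^ 2 + (k 1 : ℝ) ^ 2 := by positivity
  fin_cases i <;> simp only [symbolI, Fin.zero_eta, Fin.mk_one, Matrix.cons_val_zero,
    Matrix.cons_val_one, Matrix.cons_val_fin_one, abs_div, abs_of_nonneg hden] <;>
    refine div_le_one_of_le₀ (abs_le.mpr ⟨?_, ?_⟩) hden <;>
    nlinarith [sq_nonneg ((k 0 : ℝ) + k 1), sq_nonneg ((k 0 : ℝ) - k 1), sq_nonneg (k 0 : ℝ),
      sq_nonneg (k 1 : ℝ)]

lemma norm_velocitySymbol_le {α : ℝ} (hα : 0 ≤ α) (i : Fin 2) (k : Fin 2 → ℤ) :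
    ‖(velocitySymbol α i k : ℂ)‖ ≤ sobolevWeight α k := by
  have hpow : 0 ≤ freqNorm k ^ α := Real.rpow_nonneg (freqNorm_nonneg k) α
  rw [Complex.norm_real, velocitySymbol, norm_mul, Real.norm_of_nonneg hpow]
  exact (mul_le_of_le_one_right hpow (abs_symbolI_le_one k i)).trans
    (freqNorm_rpow_le_sobolevWeight hα k)

lemma abs_le_freqNorm (k : Fin 2 → ℤ) (i : Fin 2) : |(k i : ℝ)| ≤ freqNorm k := by
  refine Real.abs_le_sqrt ?_
  fin_cases i
  · exact le_add_of_nonneg_right (sq_nonneg _)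
  · exact le_add_of_nonneg_left (sq_nonneg _)

lemma norm_gradientSymbol_le (i : Fin 2) (k : Fin 2 → ℤ) :
    ‖Complex.I * (k i : ℂ)‖ ≤ sobolevWeight 1 k := by
  rw [norm_mul, Complex.norm_I, one_mul, Complex.norm_intCast]
  exact (abs_le_freqNorm k i).trans (by
    simpa only [Real.rpow_one] using freqNorm_rpow_le_sobolevWeight zero_le_one k)

lemma norm_le_of_isMultiplierImage {a q : ℝ} {M : ℝ≥0} {m : (Fin 2 → ℤ) → ℂ} {f g : L2}
    (haq : a ≤ q) (hm : ∀ k, ‖m k‖ ≤ sobolevWeight a k) (h : IsMultiplierImage m f g)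
    (hf : sobolevNorm q f ≤ M) : ‖g‖ ≤ 2 * Real.pi * M := by
  rw [sobolevNorm_eq_weightedNorm] at hf
  simpa using h.norm_le (δ := 1) (C := 0)
    (fun k => by simpa using (hm k).trans (sobolevWeight_mono haq k)) hf


/-- The cosine `x ↦ cos (k · x)`. -/
def cosine (k : Fin 2 → ℤ) (x : Torus) : ℝ := (character k x).re

lemma continuous_cosine (k : Fin 2 → ℤ) : Continuous (cosine k) :=
  Complex.continuous_re.comp (continuous_character k)

lemma abs_cosine_le_one (k : Fin 2 → ℤ) (x : Torus) : |cosine k x| ≤ 1 :=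
  (Complex.abs_re_le_norm _).trans (norm_character k x).le

lemma smoothOnTorus_cosine (k : Fin 2 → ℤ) : SmoothOnTorus (cosine k) := by
  unfold SmoothOnTorus cosine character
  simp only [fourier_coe_apply, Fin.prod_univ_two]
  have hcoord (i : Fin 2) : ContDiff ℝ ∞ fun x : Fin 2 → ℝ => (x i : ℂ) :=
    ContDiff.comp (g := Complex.ofRealCLM) Complex.ofRealCLM.contDiff (contDiff_apply ℝ ℝ i)
  have hre : ContDiff ℝ ∞ Complex.re := Complex.reCLM.contDiff
  refine hre.comp ?_
  fun_prop

lemma two_mul_cosine_mul_cosine (k l : Fin 2 → ℤ) (x : Torus) :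
    2 * cosine k x * cosine l x = cosine (l + k) x + cosine (l - k) x := by
  simp only [cosine, sub_eq_add_neg, character_add, character_neg, Complex.mul_re, Complex.conj_re,
    Complex.conj_im]
  ring

lemma integrable_mul_cosine (f : L2) (k : Fin 2 → ℤ) :
    Integrable (fun x : Torus => f x * cosine k x) :=
  ((Lp.memLp f).integrable one_le_two).mul_bdd (continuous_cosine k).aestronglyMeasurable
    (ae_of_all _ (abs_cosine_le_one k))

lemma integral_mul_cosine (f : L2) (k : Fin 2 → ℤ) :
    ∫ x : Torus, f x * cosine k x = (2 * Real.pi) ^ 2 * (coeff f k).re := by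
  have hre : (∫ x : Torus, (f x : ℂ) * character (-k) x).re = ∫ x : Torus, f x * cosine k x := by
    rw [← RCLike.re_eq_complex_re, ← integral_re (integrable_mul_character f (-k))]
    simp [character_neg, cosine]
  rw [coeff, ← Complex.ofReal_inv, ← Complex.ofReal_pow, Complex.re_ofReal_mul, hre, ← mul_assoc,
    ← mul_pow, mul_inv_cancel₀ Real.two_pi_pos.ne', one_pow, one_mul]

/-- Multiplication by `cos (k · x)`, as a bounded operator on `L²`. -/
def cosineMul (k : Fin 2 → ℤ) : L2 →L[ℝ] L2 :=
  (ContinuousLinearMap.mul ℝ ℝ).holderL volume ∞ 2 2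
    (ContinuousMap.toLp (E := ℝ) ∞ volume ℝ ⟨cosine k, continuous_cosine k⟩)

lemma coeFn_cosineMul (k : Fin 2 → ℤ) (f : L2) :
    cosineMul k f =ᵐ[volume] fun x => cosine k x * f x := by
  have hcosine := ContinuousMap.coeFn_toLp (𝕜 := ℝ) (p := ∞) (volume : Measure Torus)
    ⟨cosine k, continuous_cosine k⟩
  filter_upwards [(ContinuousLinearMap.mul ℝ ℝ).coeFn_holder (r := 2)
    (ContinuousMap.toLp (E := ℝ) ∞ volume ℝ ⟨cosine k, continuous_cosine k⟩) f, hcosine]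
    with x hx hcos
  rw [hcos] at hx
  exact hx

lemma norm_cosineMul_le (k : Fin 2 → ℤ) (f : L2) : ‖cosineMul k f‖ ≤ ‖f‖ := by
  refine Lp.norm_le_norm_of_ae_le ?_
  filter_upwards [coeFn_cosineMul k f] with x hx
  rw [hx, norm_mul]
  exact mul_le_of_le_one_left (norm_nonneg _) (abs_cosine_le_one k x)

lemma inner_cosineMul (k : Fin 2 → ℤ) (f g : L2) :
    inner ℝ f (cosineMul k g) = ∫ x, f x * g x * cosine k x := by
  rw [L2.inner_def]
  refine integral_congr_ae ?_
  filter_upwards [coeFn_cosineMul k g] with x hx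
  rw [hx, RCLike.inner_apply, conj_trivial]
  ring

lemma integrable_mul_mul_cosine (k : Fin 2 → ℤ) (f g : L2) :
    Integrable fun x : Torus => f x * g x * cosine k x := by
  refine (L2.integrable_inner (𝕜 := ℝ) f (cosineMul k g)).congr ?_
  filter_upwards [coeFn_cosineMul k g] with x hx
  rw [hx, RCLike.inner_apply, conj_trivial]
  ring

/-- The real part of `z exp (i k · x)`, as an element of `L²`. -/
def mode (z : ℂ) (k : Fin 2 → ℤ) : L2 :=
  ContinuousMap.toLp (E := ℝ) 2 volume ℝ
    ⟨fun x => (z * character k x).re,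
      Complex.continuous_re.comp (continuous_const.mul (continuous_character k))⟩

lemma coeFn_mode (z : ℂ) (k : Fin 2 → ℤ) :
    mode z k =ᵐ[volume] fun x => (z * character k x).re :=
  ContinuousMap.coeFn_toLp (𝕜 := ℝ) (p := 2) (volume : Measure Torus) _

lemma coeff_mode (z : ℂ) (k : Fin 2 → ℤ) :
    coeff (mode z k) = Pi.single k (z / 2) + Pi.single (-k) (conj z / 2) := by
  ext l
  have hsplit : ∫ x : Torus, (mode z k x : ℂ) * character (-l) x
      = ∫ x : Torus, (z / 2 * character (k - l) x + conj z / 2 * character (-k - l) x) := by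
    refine integral_congr_ae ?_
    filter_upwards [coeFn_mode z k] with x hx
    rw [hx, Complex.re_eq_add_conj, sub_eq_add_neg, sub_eq_add_neg, character_add, character_add,
      character_neg k, map_mul]
    ring
  have hint (c : ℂ) (m : Fin 2 → ℤ) : Integrable fun x : Torus => c * character m x :=
    (continuous_const.mul (continuous_character m)).integrable_of_hasCompactSupport
      (HasCompactSupport.of_compactSpace _)
  have hpi : ((2 * Real.pi : ℝ) : ℂ) ≠ 0 := Complex.ofReal_ne_zero.mpr Real.two_pi_pos.ne'
  rw [coeff, hsplit, integral_add (hint _ _) (hint _ _), integral_const_mul, integral_const_mul,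
    integral_character, integral_character, Pi.add_apply, Pi.single_apply, Pi.single_apply]
  simp only [sub_eq_zero, eq_comm (a := l)]
  split_ifs <;> field_simp <;> ring

lemma mode_zero (k : Fin 2 → ℤ) : mode 0 k = 0 := by
  refine Lp.eq_zero_iff_ae_eq_zero.mpr ?_
  filter_upwards [coeFn_mode 0 k] with x hx
  simp [hx]

lemma coeff_mode_of_ne (z : ℂ) {k l : Fin 2 → ℤ} (h : l ≠ k) (h_neg : l ≠ -k) :
    coeff (mode z k) l = 0 := by
  rw [coeff_mode, Pi.add_apply, Pi.single_eq_of_ne h, Pi.single_eq_of_ne h_neg, add_zero]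

lemma meanFree_mode (z : ℂ) {k : Fin 2 → ℤ} (hk : k ≠ 0) : MeanFree (mode z k) :=
  meanFree_iff_coeff_zero.mpr (coeff_mode_of_ne z hk.symm (neg_ne_zero.mpr hk).symm)

lemma weightedNorm_mode_le {w : (Fin 2 → ℤ) → ℝ} {k : Fin 2 → ℤ} (hw : w (-k) = w k) (z : ℂ) :
    weightedNorm w (mode z k) ≤ ENNReal.ofReal (|w k| * ‖z‖) := by
  have hsingle (l : Fin 2 → ℤ) (c : ℂ) :
      eLpNorm (fun l' => (w l' : ℂ) * (Pi.single l c : (Fin 2 → ℤ) → ℂ) l') 2 Measure.count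
        = ENNReal.ofReal (|w l| * ‖c‖) := by
    have hfun : (fun l' => (w l' : ℂ) * (Pi.single l c : (Fin 2 → ℤ) → ℂ) l')
        = ({l} : Set (Fin 2 → ℤ)).indicator fun _ => (w l : ℂ) * c := by
      ext l'
      obtain rfl | hl := eq_or_ne l' l
      · simp
      · simp [hl]
    rw [hfun, eLpNorm_indicator_const (measurableSet_singleton l) two_ne_zero ENNReal.ofNat_ne_top,
      Measure.count_singleton, ENNReal.one_rpow, mul_one, ← ofReal_norm, norm_mul,
      Complex.norm_real, Real.norm_eq_abs]
  simp only [weightedNorm, coeff_mode, Pi.add_apply, mul_add]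
  refine (eLpNorm_add_le .of_discrete .of_discrete one_le_two).trans (le_of_eq ?_)
  rw [hsingle, hsingle, hw, ← ENNReal.ofReal_add (by positivity) (by positivity), norm_div,
    norm_div, RCLike.norm_conj, ← mul_add, Complex.norm_ofNat, add_halves]

lemma freqNorm_neg (k : Fin 2 → ℤ) : freqNorm (-k) = freqNorm k := by
  simp [freqNorm]

lemma sobolevNorm_mode_lt_top (q : ℝ) (z : ℂ) (k : Fin 2 → ℤ) : sobolevNorm q (mode z k) < ⊤ := by
  rw [sobolevNorm_eq_weightedNorm]
  exact (weightedNorm_mode_le (by simp [sobolevWeight, freqNorm_neg]) z).trans_lt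
    ENNReal.ofReal_lt_top

lemma gevreyNorm_mode_le (r s τ : ℝ) (z : ℂ) (k : Fin 2 → ℤ) :
    gevreyNorm r s τ (mode z k) ≤ ENNReal.ofReal (|gevreyWeight r s τ k| * ‖z‖) := by
  rw [gevreyNorm_eq_weightedNorm]
  exact weightedNorm_mode_le (by simp [gevreyWeight, freqNorm_neg]) z

lemma isGradient_mode (z : ℂ) (k : Fin 2 → ℤ) :
    IsGradient (mode z k) fun i => mode (Complex.I * k i * z) k := by
  intro i l
  have hsingle (m : Fin 2 → ℤ) (c : ℂ) :
      Complex.I * l i * (Pi.single m c : (Fin 2 → ℤ) → ℂ) l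
        = (Pi.single m (Complex.I * m i * c) : (Fin 2 → ℤ) → ℂ) l := by
    obtain rfl | hl := eq_or_ne l m
    · simp
    · simp [hl]
  simp only [coeff_mode, Pi.add_apply, mul_add, hsingle, map_mul, Complex.conj_I, Pi.neg_apply,
    Int.cast_neg, map_intCast]
  ring_nf

lemma velocitySymbol_eq_zero (α : ℝ) (i : Fin 2) {k : Fin 2 → ℤ} (hk : k 0 = 0) :
    velocitySymbol α i k = 0 := by
  fin_cases i <;> simp [velocitySymbol, symbolI, hk]

lemma velocitySymbol_mul_coeff_mode (α : ℝ) (i : Fin 2) (z : ℂ) {k : Fin 2 → ℤ} (hk : k 0 = 0)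
    (l : Fin 2 → ℤ) : (velocitySymbol α i l : ℂ) * coeff (mode z k) l = 0 := by
  by_cases hl : l 0 = 0
  · rw [velocitySymbol_eq_zero α i hl, Complex.ofReal_zero, zero_mul]
  · rw [coeff_mode_of_ne, mul_zero] <;> rintro rfl <;> simp [hk] at hl

lemma isVelocity_mode_zero (α : ℝ) (z : ℂ) {k : Fin 2 → ℤ} (hk : k 0 = 0) :
    IsVelocity α (mode z k) 0 := fun i l => by
  rw [Pi.zero_apply, coeff_zero]
  exact (velocitySymbol_mul_coeff_mode α i z hk l).symm

lemma isSolution_const {α q T : ℝ} {θ : L2} {g : Fin 2 → L2} (hq : sobolevNorm q θ < ⊤)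
    (hmean : MeanFree θ) (hu : IsVelocity α θ 0) (hg : IsGradient θ g) :
    IsSolution α q T θ fun _ => θ where
  continuousOn := continuousOn_const
  bounded := ⟨(sobolevNorm q θ).toNNReal, fun _ _ => (ENNReal.coe_toNNReal hq.ne).ge⟩
  meanFree _ _ := hmean
  initial := rfl
  equation := by
    refine ⟨fun _ => 0, fun _ => g, fun _ _ => ⟨hu, hg⟩, fun φ _ t _ => ?_⟩
    simp

lemma IsSolution.mono {α q T T' : ℝ} {θ₀ : L2} {θ : ℝ → L2} (h : IsSolution α q T' θ₀ θ)
    (hT : T ≤ T') : IsSolution α q T θ₀ θ := by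
  have hsub : Icc 0 T ⊆ Icc 0 T' := Icc_subset_Icc_right hT
  obtain ⟨M, hM⟩ := h.bounded
  obtain ⟨u, g, hug, hweak⟩ := h.equation
  exact ⟨h.continuousOn.mono hsub, ⟨M, fun t ht => hM t (hsub ht)⟩,
    fun t ht => h.meanFree t (hsub ht), h.initial,
    u, g, fun t ht => hug t (hsub ht), fun φ hφ t ht => hweak φ hφ t (hsub ht)⟩

/-- The stationary shear flow `-2 sin x₂`. -/
def shear : L2 := mode (2 * Complex.I) ![0, 1]

/-- The gradient `(0, -2 cos x₂)` of the shear flow. -/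
def shearGradient : Fin 2 → L2 := ![0, mode (-2 : ℝ) ![0, 1]]

lemma isGradient_shear : IsGradient shear shearGradient := by
  have hgrad := isGradient_mode (2 * Complex.I) ![0, 1]
  have hI : Complex.I * (2 * Complex.I) = (-2 : ℝ) := by
    push_cast
    linear_combination 2 * Complex.I_sq
  intro i
  fin_cases i
  · simpa [shear, shearGradient, mode_zero] using hgrad 0
  · simpa [shear, shearGradient, hI] using hgrad 1

lemma meanFree_shear : MeanFree shear :=
  meanFree_mode _ fun h => one_ne_zero (congrFun h 1)

lemma isVelocity_shear (α : ℝ) : IsVelocity α shear 0 :=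
  isVelocity_mode_zero α _ rfl

lemma isSolution_shear (α q T : ℝ) : IsSolution α q T shear fun _ => shear :=
  isSolution_const (sobolevNorm_mode_lt_top q _ _) meanFree_shear (isVelocity_shear α)
    isGradient_shear

lemma inner_cosineMul_mode (k l : Fin 2 → ℤ) (a : ℝ) (f : L2) :
    inner ℝ f (cosineMul l (mode a k))
      = a / 2 * (2 * Real.pi) ^ 2 * ((coeff f (l + k)).re + (coeff f (l - k)).re) := by
  calc inner ℝ f (cosineMul l (mode a k))
      = ∫ x, f x * mode a k x * cosine l x := inner_cosineMul l f _
    _ = ∫ x, a / 2 * (f x * cosine (l + k) x + f x * cosine (l - k) x) := by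
        refine integral_congr_ae ?_
        filter_upwards [coeFn_mode a k] with x hx
        rw [hx, Complex.re_ofReal_mul]
        change f x * (a * cosine k x) * cosine l x = _
        linear_combination a / 2 * f x * two_mul_cosine_mul_cosine k l x
    _ = _ := by
        rw [integral_const_mul, integral_add (integrable_mul_cosine f _)
          (integrable_mul_cosine f _), integral_mul_cosine, integral_mul_cosine]
        ring

section Comparison

variable {ι : Type*} {s : ι → Finset ι} {a : ι → ι → ℝ} {C T : ℝ}

lemma neg_mul_pow_div_factorial_le_of_integral_sum_le {M : ℝ} {w : ι → ℝ → ℝ}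
    (ha : ∀ j, ∀ i ∈ s j, 0 ≤ a j i) (haC : ∀ j, ∑ i ∈ s j, a j i ≤ C) (hC : 0 ≤ C)
    (hw : ∀ j, ContinuousOn (w j) (Icc 0 T)) (hM : ∀ j, ∀ t ∈ Icc 0 T, |w j t| ≤ M)
    (hint : ∀ j, ∀ t ∈ Icc 0 T, ∫ x in (0 : ℝ)..t, ∑ i ∈ s j, a j i * w i x ≤ w j t)
    (m : ℕ) (j : ι) {t : ℝ} (ht : t ∈ Icc 0 T) : -(M * ((C * t) ^ m / m.factorial)) ≤ w j t := by
  induction m generalizing j t with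
  | zero => simpa using (abs_le.mp (hM j t ht)).1
  | succ m ih =>
    have hsub : Icc 0 t ⊆ Icc 0 T := Icc_subset_Icc_right ht.2
    have hM_nonneg : 0 ≤ M := (abs_nonneg _).trans (hM j t ht)
    have hprimitive : ∫ x in (0 : ℝ)..t, -(M * C * ((C * x) ^ m / m.factorial))
        = -(M * ((C * t) ^ (m + 1) / (m + 1).factorial)) := by
      simp only [mul_pow, intervalIntegral.integral_neg, intervalIntegral.integral_const_mul,
        intervalIntegral.integral_div, integral_pow, Nat.factorial_succ]
      push_cast
      field_simp
      ring
    rw [← hprimitive]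
    refine (intervalIntegral.integral_mono_on ht.1 ?_ ?_ fun x hx => ?_).trans (hint j t ht)
    · exact (by fun_prop : Continuous _).intervalIntegrable _ _
    · exact (continuousOn_finsetSum _ fun i _ => continuousOn_const.mul ((hw i).mono
        hsub)).intervalIntegrable_of_Icc ht.1
    · have hx_nonneg : 0 ≤ x := hx.1
      calc -(M * C * ((C * x) ^ m / m.factorial))
          = -(C * (M * ((C * x) ^ m / m.factorial))) := by ring
        _ ≤ -((∑ i ∈ s j, a j i) * (M * ((C * x) ^ m / m.factorial))) := by
          gcongr
          exact haC j
        _ = ∑ i ∈ s j, a j i * -(M * ((C * x) ^ m / m.factorial)) := by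
          rw [← Finset.sum_mul, mul_neg]
        _ ≤ ∑ i ∈ s j, a j i * w i x := Finset.sum_le_sum fun i hi =>
          mul_le_mul_of_nonneg_left (ih i (hsub hx)) (ha j i hi)

lemma nonneg_of_integral_sum_le {M : ℝ} {w : ι → ℝ → ℝ}
    (ha : ∀ j, ∀ i ∈ s j, 0 ≤ a j i) (haC : ∀ j, ∑ i ∈ s j, a j i ≤ C) (hC : 0 ≤ C)
    (hw : ∀ j, ContinuousOn (w j) (Icc 0 T)) (hM : ∀ j, ∀ t ∈ Icc 0 T, |w j t| ≤ M)
    (hint : ∀ j, ∀ t ∈ Icc 0 T, ∫ x in (0 : ℝ)..t, ∑ i ∈ s j, a j i * w i x ≤ w j t)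
    (j : ι) {t : ℝ} (ht : t ∈ Icc 0 T) : 0 ≤ w j t := by
  have hlim : Tendsto (fun m : ℕ => -(M * ((C * t) ^ m / m.factorial))) atTop (𝓝 0) := by
    simpa using ((FloorSemiring.tendsto_pow_div_factorial_atTop (C * t)).const_mul M).neg
  exact le_of_tendsto' hlim fun m =>
    neg_mul_pow_div_factorial_le_of_integral_sum_le ha haC hC hw hM hint m j ht

lemma le_of_integral_subsolution {E M P : ℝ} {p z e : ι → ℝ → ℝ} {z₀ : ι → ℝ}
    (ha : ∀ j, ∀ i ∈ s j, 0 ≤ a j i) (haC : ∀ j, ∑ i ∈ s j, a j i ≤ C) (hC : 0 ≤ C)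
    (hp : ∀ j, ContinuousOn (p j) (Icc 0 T)) (hpP : ∀ j, ∀ t ∈ Icc 0 T, |p j t| ≤ P)
    (hp_le : ∀ j, ∀ t ∈ Icc 0 T,
      p j t ≤ z₀ j + ∫ x in (0 : ℝ)..t, ((∑ i ∈ s j, a j i * p i x) - E))
    (hz : ∀ j, ContinuousOn (z j) (Icc 0 T)) (hzM : ∀ j, ∀ t ∈ Icc 0 T, |z j t| ≤ M)
    (he : ∀ j, ContinuousOn (e j) (Icc 0 T)) (heE : ∀ j, ∀ t ∈ Icc 0 T, -E ≤ e j t)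
    (hz_eq : ∀ j, ∀ t ∈ Icc 0 T,
      z j t = z₀ j + ∫ x in (0 : ℝ)..t, ((∑ i ∈ s j, a j i * z i x) + e j x))
    (j : ι) {t : ℝ} (ht : t ∈ Icc 0 T) : p j t ≤ z j t := by
  have hsum_cont {y : ι → ℝ → ℝ} (hy : ∀ j, ContinuousOn (y j) (Icc 0 T)) (j : ι) :
      ContinuousOn (fun x => ∑ i ∈ s j, a j i * y i x) (Icc 0 T) :=
    continuousOn_finsetSum _ fun i _ => continuousOn_const.mul (hy i)
  have hw_bound (j : ι) (t : ℝ) (ht : t ∈ Icc 0 T) : |z j t - p j t| ≤ M + P :=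
    (abs_sub _ _).trans (add_le_add (hzM j t ht) (hpP j t ht))
  refine sub_nonneg.mp (nonneg_of_integral_sum_le (w := fun j t => z j t - p j t) ha haC hC
    (fun j => (hz j).sub (hp j)) hw_bound (fun j t ht => ?_) j ht)
  have hsub : Icc 0 t ⊆ Icc 0 T := Icc_subset_Icc_right ht.2
  have hint_z : IntervalIntegrable (fun x => (∑ i ∈ s j, a j i * z i x) + e j x) volume 0 t :=
    (((hsum_cont hz j).add (he j)).mono hsub).intervalIntegrable_of_Icc ht.1
  have hint_p : IntervalIntegrable (fun x => (∑ i ∈ s j, a j i * p i x) - E) volume 0 t :=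
    (((hsum_cont hp j).sub continuousOn_const).mono hsub).intervalIntegrable_of_Icc ht.1
  calc ∫ x in (0 : ℝ)..t, ∑ i ∈ s j, a j i * (z i x - p i x)
      ≤ ∫ x in (0 : ℝ)..t,
          (((∑ i ∈ s j, a j i * z i x) + e j x) - ((∑ i ∈ s j, a j i * p i x) - E)) := by
        refine intervalIntegral.integral_mono_on ht.1
          (((hsum_cont (fun i => (hz i).sub (hp i)) j).mono hsub).intervalIntegrable_of_Icc ht.1)
          (hint_z.sub hint_p) fun x hx => ?_
        simp only [mul_sub, Finset.sum_sub_distrib]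
        linarith [heE j x (hsub hx)]
    _ ≤ z j t - p j t := by
        rw [intervalIntegral.integral_sub hint_z hint_p]
        linarith [hz_eq j t ht, hp_le j t ht]

lemma hasDerivAt_mul_exp (E C t : ℝ) :
    HasDerivAt (fun t => E * t * Real.exp (C * t))
      (E * Real.exp (C * t) + C * (E * t * Real.exp (C * t))) t := by
  refine (((hasDerivAt_id t).const_mul E).mul ((hasDerivAt_id t).const_mul C).exp).congr_deriv ?_
  simp only [id]
  ring

/-- `E t exp (C t)` bounds the Duhamel integral `∫ E exp (C (t - x)) dx` of the forcing `E`. -/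
lemma sub_mul_exp_le_integral {E : ℝ} {p p' : ι → ℝ → ℝ}
    (haC : ∀ j, ∑ i ∈ s j, a j i ≤ C) (hC : 0 ≤ C) (hE : 0 ≤ E)
    (hp : ∀ j t, HasDerivAt (p j) (p' j t) t)
    (hp_sub : ∀ j, ∀ t ∈ Icc 0 T, p' j t ≤ ∑ i ∈ s j, a j i * p i t)
    (j : ι) {t : ℝ} (ht : t ∈ Icc 0 T) :
    p j t - E * t * Real.exp (C * t) ≤ p j 0 + ∫ x in (0 : ℝ)..t,
      ((∑ i ∈ s j, a j i * (p i x - E * x * Real.exp (C * x))) - E) := by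
  have hp_cont (j : ι) : Continuous (p j) :=
    continuous_iff_continuousAt.mpr fun t => (hp j t).continuousAt
  have hint : IntegrableOn (fun x => (∑ i ∈ s j, a j i * (p i x - E * x * Real.exp (C * x))) - E)
      (Icc 0 t) := (by fun_prop : Continuous _).continuousOn.integrableOn_Icc
  have hcomparison := intervalIntegral.sub_le_integral_of_hasDeriv_right_of_le ht.1
    ((hp_cont j).sub (by fun_prop : Continuous fun t => E * t * Real.exp (C * t))).continuousOn
    (fun x _ => ((hp j x).sub (hasDerivAt_mul_exp E C x)).hasDerivWithinAt) hint fun x hx => by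
      have hsub := hp_sub j x ⟨hx.1.le, hx.2.le.trans ht.2⟩
      have hduhamel : 0 ≤ E * x * Real.exp (C * x) :=
        mul_nonneg (mul_nonneg hE hx.1.le) (Real.exp_nonneg _)
      have hrow := mul_le_mul_of_nonneg_right (haC j) hduhamel
      have hexp : E ≤ E * Real.exp (C * x) :=
        le_mul_of_one_le_right hE (Real.one_le_exp (mul_nonneg hC hx.1.le))
      simp only [mul_sub, Finset.sum_sub_distrib, ← Finset.sum_mul]
      linarith
  simp only [Pi.sub_apply, mul_zero, zero_mul, sub_zero] at hcomparison
  exact sub_le_iff_le_add'.mp hcomparison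

lemma sub_mul_exp_le_of_integral_eq {E M P : ℝ} {p p' z e : ι → ℝ → ℝ} {z₀ : ι → ℝ}
    (ha : ∀ j, ∀ i ∈ s j, 0 ≤ a j i) (haC : ∀ j, ∑ i ∈ s j, a j i ≤ C) (hC : 0 ≤ C) (hE : 0 ≤ E)
    (hp : ∀ j t, HasDerivAt (p j) (p' j t) t)
    (hp_sub : ∀ j, ∀ t ∈ Icc 0 T, p' j t ≤ ∑ i ∈ s j, a j i * p i t)
    (hp₀ : ∀ j, p j 0 ≤ z₀ j) (hpP : ∀ j, ∀ t ∈ Icc 0 T, |p j t| ≤ P)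
    (hz : ∀ j, ContinuousOn (z j) (Icc 0 T)) (hzM : ∀ j, ∀ t ∈ Icc 0 T, |z j t| ≤ M)
    (he : ∀ j, ContinuousOn (e j) (Icc 0 T)) (heE : ∀ j, ∀ t ∈ Icc 0 T, -E ≤ e j t)
    (hz_eq : ∀ j, ∀ t ∈ Icc 0 T,
      z j t = z₀ j + ∫ x in (0 : ℝ)..t, ((∑ i ∈ s j, a j i * z i x) + e j x))
    (j : ι) {t : ℝ} (ht : t ∈ Icc 0 T) : p j t - E * t * Real.exp (C * t) ≤ z j t := by
  refine le_of_integral_subsolution (p := fun j t => p j t - E * t * Real.exp (C * t))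
    (P := P + E * T * Real.exp (C * T)) ha haC hC (fun j => ?_) (fun j t ht => ?_)
    (fun j t ht => ?_) hz hzM he heE hz_eq j ht
  · exact fun x _ => ((hp j x).sub (hasDerivAt_mul_exp E C x)).continuousAt.continuousWithinAt
  · have ht_nonneg : 0 ≤ t := ht.1
    have hT : 0 ≤ T := ht.1.trans ht.2
    refine (abs_sub _ _).trans (add_le_add (hpP j t ht) ?_)
    rw [abs_of_nonneg (by positivity)]
    gcongr <;> exact ht.2
  · exact (sub_mul_exp_le_integral haC hC hE hp hp_sub j ht).trans (add_le_add_left (hp₀ j) _)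

end Comparison

/-- The subsolution of the system with nearest-neighbour coupling on `ℤ` which lives on the pair of
sites `0` and `1` and grows at rate `l`. -/
def twoSiteGrowth (l : ℝ) (j : ℤ) (t : ℝ) : ℝ :=
  if j = 0 then Real.cosh (l * t) else if j = 1 then Real.sinh (l * t) else 0

lemma hasDerivAt_twoSiteGrowth (l : ℝ) (j : ℤ) (t : ℝ) :
    HasDerivAt (twoSiteGrowth l j)
      (if j = 0 then l * Real.sinh (l * t) else if j = 1 then l * Real.cosh (l * t) else 0) t := by
  have hlin : HasDerivAt (fun t : ℝ => l * t) l t := by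
    simpa using (hasDerivAt_id t).const_mul l
  unfold twoSiteGrowth
  split_ifs
  · exact hlin.cosh.congr_deriv (mul_comm _ _)
  · exact hlin.sinh.congr_deriv (mul_comm _ _)
  · exact hasDerivAt_const t 0

lemma twoSiteGrowth_nonneg {l t : ℝ} (hl : 0 ≤ l) (ht : 0 ≤ t) (j : ℤ) :
    0 ≤ twoSiteGrowth l j t := by
  unfold twoSiteGrowth
  split_ifs
  · exact (Real.cosh_pos _).le
  · exact Real.sinh_nonneg_iff.mpr (mul_nonneg hl ht)
  · exact le_rfl

lemma twoSiteGrowth_le_cosh {l t T : ℝ} (hl : 0 ≤ l) (ht : t ∈ Icc 0 T) (j : ℤ) :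
    twoSiteGrowth l j t ≤ Real.cosh (l * T) := by
  have hcosh : Real.cosh (l * t) ≤ Real.cosh (l * T) := by
    rw [Real.cosh_le_cosh, abs_of_nonneg (mul_nonneg hl ht.1),
      abs_of_nonneg (mul_nonneg hl (ht.1.trans ht.2))]
    exact mul_le_mul_of_nonneg_left ht.2 hl
  unfold twoSiteGrowth
  split_ifs
  · exact hcosh
  · exact (Real.sinh_lt_cosh _).le.trans hcosh
  · exact (Real.cosh_pos _).le

lemma deriv_twoSiteGrowth_le {l t : ℝ} {b : ℤ → ℝ} (hl : 0 ≤ l) (ht : 0 ≤ t) (hb : ∀ j, 0 ≤ b j)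
    (hb₀ : l ≤ b 0) (hb₁ : l ≤ b 1) (j : ℤ) :
    (if j = 0 then l * Real.sinh (l * t) else if j = 1 then l * Real.cosh (l * t) else 0)
      ≤ b (j - 1) * twoSiteGrowth l (j - 1) t + b (j + 1) * twoSiteGrowth l (j + 1) t := by
  have hleft := mul_nonneg (hb (j - 1)) (twoSiteGrowth_nonneg hl ht (j - 1))
  have hright := mul_nonneg (hb (j + 1)) (twoSiteGrowth_nonneg hl ht (j + 1))
  split_ifs with h₀ h₁
  · subst h₀
    exact le_add_of_nonneg_of_le hleft
      (mul_le_mul_of_nonneg_right hb₁ (twoSiteGrowth_nonneg hl ht 1))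
  · subst h₁
    exact le_add_of_le_of_nonneg
      (mul_le_mul_of_nonneg_right hb₀ (twoSiteGrowth_nonneg hl ht 0)) hright
  · exact add_nonneg hleft hright

lemma mul_cosh_sub_le_of_integral_eq {T B E M ε l : ℝ} {b : ℤ → ℝ} {z e : ℤ → ℝ → ℝ}
    (hT : 0 ≤ T) (hE : 0 ≤ E) (hε : 0 ≤ ε) (hl : 0 ≤ l)
    (hb : ∀ j, 0 ≤ b j) (hbB : ∀ j, b j ≤ B) (hb₀ : l ≤ b 0) (hb₁ : l ≤ b 1)
    (hz : ∀ j, ContinuousOn (z j) (Icc 0 T)) (hzM : ∀ j, ∀ t ∈ Icc 0 T, |z j t| ≤ M)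
    (he : ∀ j, ContinuousOn (e j) (Icc 0 T)) (heE : ∀ j, ∀ t ∈ Icc 0 T, |e j t| ≤ E)
    (hz_eq : ∀ j, ∀ t ∈ Icc 0 T, z j t = (if j = 0 then ε else 0) + ∫ x in (0 : ℝ)..t,
      (b (j - 1) * z (j - 1) x + b (j + 1) * z (j + 1) x + e j x)) :
    ε * Real.cosh (l * T) - E * T * Real.exp (2 * B * T) ≤ z 0 T := by
  have hpair (j : ℤ) (y : ℤ → ℝ) : ∑ i ∈ {j - 1, j + 1}, y i = y (j - 1) + y (j + 1) :=
    Finset.sum_pair (by omega)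
  have hmain := sub_mul_exp_le_of_integral_eq (ι := ℤ) (s := fun j => {j - 1, j + 1})
    (a := fun _ i => b i) (C := 2 * B) (p := fun j t => ε * twoSiteGrowth l j t)
    (P := ε * Real.cosh (l * T)) (z₀ := fun j => if j = 0 then ε else 0)
    (fun _ i _ => hb i) (fun j => ?_) (by linarith [hb 0, hbB 0]) hE
    (fun j t => (hasDerivAt_twoSiteGrowth l j t).const_mul ε) (fun j t ht => ?_) (fun j => ?_)
    (fun j t ht => ?_) hz hzM he (fun j t ht => (abs_le.mp (heE j t ht)).1)
    (fun j t ht => by simpa only [hpair] using hz_eq j t ht) 0 (right_mem_Icc.mpr hT)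
  · simpa [twoSiteGrowth] using hmain
  · rw [hpair]
    linarith [hbB (j - 1), hbB (j + 1)]
  · have hsub := mul_le_mul_of_nonneg_left (deriv_twoSiteGrowth_le hl ht.1 hb hb₀ hb₁ j) hε
    rw [hpair]
    linarith
  · simp only [twoSiteGrowth, mul_zero, Real.cosh_zero, Real.sinh_zero, ite_self, mul_ite, mul_one,
      le_refl]
  · rw [abs_of_nonneg (mul_nonneg hε (twoSiteGrowth_nonneg hl ht.1 j))]
    exact mul_le_mul_of_nonneg_left (twoSiteGrowth_le_cosh hl ht j) hε

lemma velocitySymbol_one_nonneg (α : ℝ) (k : Fin 2 → ℤ) : 0 ≤ velocitySymbol α 1 k :=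
  mul_nonneg (Real.rpow_nonneg (freqNorm_nonneg k) α)
    (div_nonneg (sq_nonneg _) (add_nonneg (sq_nonneg _) (sq_nonneg _)))

lemma velocitySymbol_one_eq (α : ℝ) (k : Fin 2 → ℤ) :
    velocitySymbol α 1 k = freqNorm k ^ α * ((k 0 : ℝ) ^ 2 / freqNorm k ^ 2) := by
  rw [sq_freqNorm]
  rfl

lemma one_le_abs_intCast {n : ℤ} (hn : n ≠ 0) : 1 ≤ |(n : ℝ)| := by
  exact_mod_cast Int.one_le_abs hn

lemma velocitySymbol_one_le_sq {α : ℝ} (hα : α ≤ 2) (k : Fin 2 → ℤ) :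
    velocitySymbol α 1 k ≤ (k 0 : ℝ) ^ 2 := by
  obtain hk | hk := eq_or_ne (k 0) 0
  · rw [velocitySymbol_eq_zero α 1 hk]
    positivity
  have hone : 1 ≤ freqNorm k := (one_le_abs_intCast hk).trans (abs_le_freqNorm k 0)
  calc velocitySymbol α 1 k
      = freqNorm k ^ α * ((k 0 : ℝ) ^ 2 / freqNorm k ^ 2) := velocitySymbol_one_eq α k
    _ ≤ freqNorm k ^ (2 : ℝ) * ((k 0 : ℝ) ^ 2 / freqNorm k ^ 2) := by gcongr
    _ = (k 0 : ℝ) ^ 2 := by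
        rw [Real.rpow_two, mul_div_cancel₀]
        positivity

lemma half_rpow_le_velocitySymbol_one {α : ℝ} (hα : 0 ≤ α) {k : Fin 2 → ℤ} (hk : k 0 ≠ 0)
    (hk_le : |(k 1 : ℝ)| ≤ |(k 0 : ℝ)|) : |(k 0 : ℝ)| ^ α / 2 ≤ velocitySymbol α 1 k := by
  have hsq : (k 1 : ℝ) ^ 2 ≤ (k 0 : ℝ) ^ 2 := sq_le_sq.mpr hk_le
  calc |(k 0 : ℝ)| ^ α / 2 = |(k 0 : ℝ)| ^ α * (1 / 2) := div_eq_mul_one_div _ _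
    _ ≤ freqNorm k ^ α * ((k 0 : ℝ) ^ 2 / freqNorm k ^ 2) := by
        refine mul_le_mul (Real.rpow_le_rpow (abs_nonneg _) (abs_le_freqNorm k 0) hα) ?_
          (by positivity) (Real.rpow_nonneg (freqNorm_nonneg k) α)
        rw [sq_freqNorm, div_le_div_iff₀ two_pos (by positivity)]
        linarith
    _ = velocitySymbol α 1 k := (velocitySymbol_one_eq α k).symm

lemma inner_cosineMul_mode_zero (k : Fin 2 → ℤ) (f : L2) :
    inner ℝ f (cosineMul k (mode (1 : ℝ) 0)) = (2 * Real.pi) ^ 2 * (coeff f k).re := by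
  rw [inner_cosineMul_mode, add_zero, sub_zero]
  ring

lemma continuous_re_coeff (k : Fin 2 → ℤ) : Continuous fun f : L2 => (coeff f k).re := by
  have heq : (fun f : L2 => (coeff f k).re)
      = fun f => ((2 * Real.pi) ^ 2)⁻¹ * inner ℝ f (cosineMul k (mode (1 : ℝ) 0)) := by
    ext f
    rw [inner_cosineMul_mode_zero, inv_mul_cancel_left₀ (by positivity)]
  rw [heq]
  fun_prop

/-- The real part of the Fourier coefficient of `-v · w` at the frequency `k`. It is the quadratic
contribution of a perturbation with velocity `v` and gradient `w` to the evolution of its own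
coefficient. -/
def transportCoeff (v w : Fin 2 → L2) (k : Fin 2 → ℤ) : ℝ :=
  -(((2 * Real.pi) ^ 2)⁻¹ * ∑ i, inner ℝ (v i) (cosineMul k (w i)))

lemma abs_transportCoeff_le {M : ℝ} {v w : Fin 2 → L2} (hv : ∀ i, ‖v i‖ ≤ 2 * Real.pi * M)
    (hw : ∀ i, ‖w i‖ ≤ 2 * Real.pi * M) (k : Fin 2 → ℤ) : |transportCoeff v w k| ≤ 2 * M ^ 2 := by
  have hterm (i : Fin 2) : |inner ℝ (v i) (cosineMul k (w i))| ≤ (2 * Real.pi * M) ^ 2 := by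
    rw [sq]
    exact (abs_real_inner_le_norm _ _).trans (mul_le_mul (hv i)
      ((norm_cosineMul_le k _).trans (hw i)) (norm_nonneg _) ((norm_nonneg _).trans (hv i)))
  calc |transportCoeff v w k|
      = ((2 * Real.pi) ^ 2)⁻¹ * |∑ i, inner ℝ (v i) (cosineMul k (w i))| := by
        rw [transportCoeff, abs_neg, abs_mul, abs_of_nonneg (by positivity)]
    _ ≤ ((2 * Real.pi) ^ 2)⁻¹ * ∑ _i : Fin 2, (2 * Real.pi * M) ^ 2 := by
        gcongr
        exact (Finset.abs_sum_le_sum_abs _ _).trans (Finset.sum_le_sum fun i _ => hterm i)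
    _ = 2 * M ^ 2 := by
        rw [Fin.sum_univ_two]
        field_simp
        ring

lemma continuousOn_transportCoeff {S : Set ℝ} {v w : ℝ → Fin 2 → L2}
    (hv : ∀ i, ContinuousOn (fun t => v t i) S) (hw : ∀ i, ContinuousOn (fun t => w t i) S)
    (k : Fin 2 → ℤ) : ContinuousOn (fun t => transportCoeff (v t) (w t) k) S :=
  (continuousOn_const.mul (continuousOn_finsetSum _ fun i _ =>
    (hv i).inner ((cosineMul k).continuous.comp_continuousOn (hw i)))).neg

lemma integral_transport_mul_cosine (v w : Fin 2 → L2) (k : Fin 2 → ℤ) :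
    ∫ x : Torus, (∑ i, v i x * w i x) * cosine k x
      = -((2 * Real.pi) ^ 2 * transportCoeff v w k) := by
  simp only [Finset.sum_mul]
  rw [integral_finsetSum _ fun i _ => integrable_mul_mul_cosine k (v i) (w i), transportCoeff,
    mul_neg, neg_neg, mul_inv_cancel_left₀ (by positivity)]
  simp only [inner_cosineMul]

lemma transportCoeff_sub (v w w' : Fin 2 → L2) (k : Fin 2 → ℤ) :
    transportCoeff v (w - w') k = transportCoeff v w k - transportCoeff v w' k := by
  simp only [transportCoeff, Pi.sub_apply, map_sub, inner_sub_right, Finset.sum_sub_distrib]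
  ring

lemma transportCoeff_shearGradient (v : Fin 2 → L2) (k : Fin 2 → ℤ) :
    transportCoeff v shearGradient k
      = (coeff (v 1) (k - ![0, 1])).re + (coeff (v 1) (k + ![0, 1])).re := by
  simp only [transportCoeff, shearGradient, Fin.sum_univ_two, Matrix.cons_val_zero,
    Matrix.cons_val_one, Matrix.cons_val_fin_one, map_zero, inner_zero_right, inner_cosineMul_mode]
  field_simp
  ring

lemma IsVelocity.sub_shear {α : ℝ} {θ : L2} {u : Fin 2 → L2} (hu : IsVelocity α θ u) :
    IsVelocity α (θ - shear) u := fun i => by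
  simpa only [Pi.zero_apply, sub_zero] using (hu i).sub (isVelocity_shear α i)

lemma IsVelocity.re_coeff {α : ℝ} {θ : L2} {u : Fin 2 → L2} (hu : IsVelocity α θ u)
    (k : Fin 2 → ℤ) : (coeff (u 1) k).re = velocitySymbol α 1 k * (coeff θ k).re := by
  rw [hu 1 k, Complex.re_ofReal_mul, velocitySymbol]

lemma transportCoeff_of_isVelocity {α : ℝ} {ρ : L2} {v g : Fin 2 → L2} (hv : IsVelocity α ρ v)
    (k : Fin 2 → ℤ) : transportCoeff v g k
      = velocitySymbol α 1 (k - ![0, 1]) * (coeff ρ (k - ![0, 1])).re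
        + velocitySymbol α 1 (k + ![0, 1]) * (coeff ρ (k + ![0, 1])).re
        + transportCoeff v (g - shearGradient) k := by
  rw [transportCoeff_sub, transportCoeff_shearGradient, hv.re_coeff, hv.re_coeff]
  ring

lemma re_coeff_sub_eq_integral {t : ℝ} {θ θ₀ : L2} {u g : ℝ → Fin 2 → L2} (k : Fin 2 → ℤ)
    (h : (∫ x : Torus, θ x * cosine k x) - (∫ x : Torus, θ₀ x * cosine k x)
      = -∫ t' in (0 : ℝ)..t, ∫ x : Torus, (∑ i, u t' i x * g t' i x) * cosine k x) :
    (coeff θ k).re - (coeff θ₀ k).re = ∫ t' in (0 : ℝ)..t, transportCoeff (u t') (g t') k := by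
  simp only [integral_transport_mul_cosine, integral_mul_cosine, intervalIntegral.integral_neg,
    intervalIntegral.integral_const_mul, neg_neg, ← mul_sub] at h
  exact mul_left_cancel₀ (by positivity) h

lemma IsSolution.exists_coeff_sub_shear_eq {α q T : ℝ} {P : L2} {θ : ℝ → L2}
    (h : IsSolution α q T (shear + P) θ) :
    ∃ v w : ℝ → Fin 2 → L2,
      (∀ t ∈ Icc 0 T, IsVelocity α (θ t - shear) (v t) ∧ IsGradient (θ t - shear) (w t)) ∧
      ∀ k, ∀ t ∈ Icc 0 T, (coeff (θ t - shear) k).re = (coeff P k).re + ∫ x in (0 : ℝ)..t,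
        (velocitySymbol α 1 (k - ![0, 1]) * (coeff (θ x - shear) (k - ![0, 1])).re
          + velocitySymbol α 1 (k + ![0, 1]) * (coeff (θ x - shear) (k + ![0, 1])).re
          + transportCoeff (v x) (w x) k) := by
  obtain ⟨u, g, hug, hweak⟩ := h.equation
  have hvel : ∀ t ∈ Icc 0 T, IsVelocity α (θ t - shear) (u t) := fun t ht =>
    (hug t ht).1.sub_shear
  refine ⟨u, fun t => g t - shearGradient, fun t ht =>
    ⟨hvel t ht, fun i => ((hug t ht).2 i).sub (isGradient_shear i)⟩, fun k t ht => ?_⟩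
  have hcoeff := re_coeff_sub_eq_integral k (hweak _ (smoothOnTorus_cosine k) t ht)
  have hsub : uIcc 0 t ⊆ Icc 0 T := uIcc_of_le ht.1 ▸ Icc_subset_Icc_right ht.2
  rw [intervalIntegral.integral_congr fun x hx =>
    transportCoeff_of_isVelocity (g := g x) (hvel x (hsub hx)) k, coeff_add, Complex.add_re]
    at hcoeff
  rw [coeff_sub, Complex.sub_re]
  linarith

lemma re_coeff_mode_line {n : ℤ} (hn : n ≠ 0) (ε : ℝ) (j : ℤ) :
    (coeff (mode (2 * ε : ℝ) ![n, 0]) ![n, j]).re = if j = 0 then ε else 0 := by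
  have hneg : (![n, j] : Fin 2 → ℤ) ≠ -![n, 0] := fun h => by
    have := congrFun h 0
    simp only [Matrix.cons_val_zero, Pi.neg_apply] at this
    omega
  split_ifs with hj
  · subst hj
    rw [coeff_mode, Pi.add_apply, Pi.single_eq_same, Pi.single_eq_of_ne hneg]
    simp
  · rw [coeff_mode_of_ne _ (fun h => hj (congrFun h 1)) hneg, Complex.zero_re]

lemma continuousOn_of_isMultiplierImage_of_lt {X : Type*} [TopologicalSpace X] {S : Set X}
    {a q : ℝ} {M : ℝ≥0} {m : (Fin 2 → ℤ) → ℂ} {f g : X → L2} (ha : 0 ≤ a) (haq : a < q)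
    (hm : ∀ k, ‖m k‖ ≤ sobolevWeight a k) (hg : ∀ t ∈ S, IsMultiplierImage m (f t) (g t))
    (hM : ∀ t ∈ S, sobolevNorm q (f t) ≤ M) (hf : ContinuousOn f S) : ContinuousOn g S := by
  simp only [sobolevNorm_eq_weightedNorm] at hM
  exact continuousOn_of_isMultiplierImage (exists_le_mul_sobolevWeight_add ha haq hm) hg hM hf

lemma abs_transportCoeff_le_of_sobolevNorm_le {α q : ℝ} {M : ℝ≥0} {ρ : L2} {v w : Fin 2 → L2}
    (hα : 0 ≤ α) (hαq : α ≤ q) (hq : 1 ≤ q) (hv : IsVelocity α ρ v) (hw : IsGradient ρ w)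
    (hM : sobolevNorm q ρ ≤ M) (k : Fin 2 → ℤ) : |transportCoeff v w k| ≤ 2 * M ^ 2 :=
  abs_transportCoeff_le
    (fun i => norm_le_of_isMultiplierImage hαq (norm_velocitySymbol_le hα i) (hv i) hM)
    (fun i => norm_le_of_isMultiplierImage hq (norm_gradientSymbol_le i) (hw i) hM) k

lemma continuousOn_transportCoeff_of_sobolevNorm_le {α q : ℝ} {M : ℝ≥0} {S : Set ℝ} {ρ : ℝ → L2}
    {v w : ℝ → Fin 2 → L2} (hα : 0 ≤ α) (hαq : α < q) (hq : 1 < q)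
    (hvw : ∀ t ∈ S, IsVelocity α (ρ t) (v t) ∧ IsGradient (ρ t) (w t))
    (hM : ∀ t ∈ S, sobolevNorm q (ρ t) ≤ M) (hρ : ContinuousOn ρ S) (k : Fin 2 → ℤ) :
    ContinuousOn (fun t => transportCoeff (v t) (w t) k) S :=
  continuousOn_transportCoeff
    (fun i => continuousOn_of_isMultiplierImage_of_lt hα hαq (norm_velocitySymbol_le hα i)
      (fun t ht => (hvw t ht).1 i) hM hρ)
    (fun i => continuousOn_of_isMultiplierImage_of_lt zero_le_one hq (norm_gradientSymbol_le i)
      (fun t ht => (hvw t ht).2 i) hM hρ) k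

lemma IsSolution.mul_cosh_sub_le {α q T ε : ℝ} {M : ℝ≥0} {n : ℤ} {θ : ℝ → L2} (hα : 0 ≤ α)
    (hα2 : α ≤ 2) (hαq : α < q) (hq : 1 < q) (hT : 0 ≤ T) (hε : 0 ≤ ε) (hn : n ≠ 0)
    (h : IsSolution α q T (shear + mode (2 * ε : ℝ) ![n, 0]) θ)
    (hM : ∀ t ∈ Icc 0 T, sobolevNorm q (θ t - shear) ≤ M) :
    ε * Real.cosh (|(n : ℝ)| ^ α / 2 * T) - 2 * M ^ 2 * T * Real.exp (2 * n ^ 2 * T) ≤ M := by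
  obtain ⟨v, w, hvw, heq⟩ := h.exists_coeff_sub_shear_eq
  have hcont : ContinuousOn (fun t => θ t - shear) (Icc 0 T) :=
    h.continuousOn.sub continuousOn_const
  have hcoeff (k) : ∀ t ∈ Icc 0 T, |(coeff (θ t - shear) k).re| ≤ M := fun t ht =>
    (Complex.abs_re_le_norm _).trans (norm_coeff_le_of_sobolevNorm_le (hα.trans hαq.le) (hM t ht) k)
  have hremainder (k) : ∀ t ∈ Icc 0 T, |transportCoeff (v t) (w t) k| ≤ 2 * M ^ 2 := fun t ht =>
    abs_transportCoeff_le_of_sobolevNorm_le hα hαq.le hq.le (hvw t ht).1 (hvw t ht).2 (hM t ht) k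
  have hrate (j : ℤ) (hj : |(j : ℝ)| ≤ 1) : |(n : ℝ)| ^ α / 2 ≤ velocitySymbol α 1 ![n, j] :=
    half_rpow_le_velocitySymbol_one (k := ![n, j]) hα hn (hj.trans (one_le_abs_intCast hn))
  have hline : ∀ j, ∀ t ∈ Icc 0 T, (coeff (θ t - shear) ![n, j]).re
      = (if j = 0 then ε else 0) + ∫ x in (0 : ℝ)..t,
        (velocitySymbol α 1 ![n, j - 1] * (coeff (θ x - shear) ![n, j - 1]).re
          + velocitySymbol α 1 ![n, j + 1] * (coeff (θ x - shear) ![n, j + 1]).re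
          + transportCoeff (v x) (w x) ![n, j]) := fun j t ht => by
    rw [← re_coeff_mode_line hn ε j]
    simpa using heq ![n, j] t ht
  refine (mul_cosh_sub_le_of_integral_eq (b := fun j => velocitySymbol α 1 ![n, j])
    hT (by positivity) hε (by positivity) (fun j => velocitySymbol_one_nonneg α _)
    (fun j => velocitySymbol_one_le_sq hα2 _) (hrate 0 (by simp)) (hrate 1 (by simp))
    (fun j => (continuous_re_coeff ![n, j]).comp_continuousOn hcont) (fun j => hcoeff ![n, j])
    (fun j => continuousOn_transportCoeff_of_sobolevNorm_le hα hαq hq hvw hM hcont ![n, j])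
    (fun j => hremainder ![n, j]) hline).trans ?_
  exact (le_abs_self _).trans (hcoeff ![n, 0] T (right_mem_Icc.mpr hT))

lemma gevreyNorm_add_le (r s τ : ℝ) (f g : L2) :
    gevreyNorm r s τ (f + g) ≤ gevreyNorm r s τ f + gevreyNorm r s τ g := by
  simp only [gevreyNorm_eq_weightedNorm]
  exact weightedNorm_add_le _ f g

lemma MeanFree.add {f g : L2} (hf : MeanFree f) (hg : MeanFree g) : MeanFree (f + g) := by
  rw [meanFree_iff_coeff_zero] at *
  rw [coeff_add, hf, hg, add_zero]

lemma gevreyNorm_mode_lt_top (r s τ : ℝ) (z : ℂ) (k : Fin 2 → ℤ) :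
    gevreyNorm r s τ (mode z k) < ⊤ :=
  (gevreyNorm_mode_le r s τ z k).trans_lt ENNReal.ofReal_lt_top

lemma exists_pos_bounds_of_isCompact {X : Type*} [TopologicalSpace X] {C : Set X} {T K : X → ℝ}
    (hC : IsCompact C) (hC_nonempty : C.Nonempty) (hT : Continuous T) (hK : Continuous K)
    (hT_pos : ∀ x, 0 < T x) (hK_pos : ∀ x, 0 < K x) :
    ∃ T₀ K₀, 0 < T₀ ∧ 0 < K₀ ∧ ∀ x ∈ C, T₀ ≤ T x ∧ K x ≤ K₀ := by
  obtain ⟨x, -, hx⟩ := hC.exists_isMinOn hC_nonempty hT.continuousOn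
  obtain ⟨y, -, hy⟩ := hC.exists_isMaxOn hC_nonempty hK.continuousOn
  exact ⟨T x, K y, hT_pos x, hK_pos y, fun z hz => ⟨hx hz, hy hz⟩⟩

lemma LocallyLipschitzWellPosed.exists_solution_near {α q r s τ : ℝ} {θ₀ : L2}
    (h : LocallyLipschitzWellPosed α q r s τ) (hθ₀ : MemGevrey r s τ θ₀)
    (hθ₀_sol : ∀ T, IsSolution α q T θ₀ fun _ => θ₀) :
    ∃ T K : ℝ, 0 < T ∧ 0 < K ∧ ∀ P, MeanFree P → gevreyNorm r s τ P ≤ 1 →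
      ∃ θ, IsSolution α q T (θ₀ + P) θ ∧
        ∀ t ∈ Icc 0 T, sobolevNorm q (θ t - θ₀) ≤ ENNReal.ofReal K * gevreyNorm r s τ P := by
  obtain ⟨T, K, hT, hK, hT_pos, hK_pos, hwell⟩ := h
  obtain ⟨hθ₀_mean, hθ₀_fin⟩ := hθ₀
  let S : ℝ≥0 := (gevreyNorm r s τ θ₀).toNNReal
  obtain ⟨T₀, K₀, hT₀, hK₀, hbounds⟩ := exists_pos_bounds_of_isCompact
    ((isCompact_Icc (a := 0) (b := S + 1)).prod (isCompact_singleton (x := S)))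
    ⟨(0, S), ⟨le_rfl, zero_le⟩, rfl⟩ hT hK hT_pos hK_pos
  refine ⟨T₀, K₀, hT₀, hK₀, fun P hP hP_le => ?_⟩
  have hsum : gevreyNorm r s τ (θ₀ + P) ≤ ((S + 1 : ℝ≥0) : ℝ≥0∞) := by
    rw [ENNReal.coe_add, ENNReal.coe_toNNReal hθ₀_fin.ne, ENNReal.coe_one]
    exact (gevreyNorm_add_le r s τ θ₀ P).trans (by gcongr)
  obtain ⟨θ, θ', hθ, hθ', hlip⟩ := hwell (θ₀ + P) θ₀
    ⟨hθ₀_mean.add hP, hsum.trans_lt ENNReal.coe_lt_top⟩ ⟨hθ₀_mean, hθ₀_fin⟩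
  obtain ⟨hT₀_le, hK₀_le⟩ := hbounds ((gevreyNorm r s τ (θ₀ + P)).toNNReal, S)
    ⟨⟨zero_le, ENNReal.toNNReal_mono ENNReal.coe_ne_top hsum⟩, rfl⟩
  refine ⟨θ, hθ.1.mono hT₀_le, fun t ht => ?_⟩
  have htT := Icc_subset_Icc_right hT₀_le ht
  have hlip_t := hlip t htT
  rw [← hθ'.2 _ (hθ₀_sol _) htT, add_sub_cancel_left] at hlip_t
  exact hlip_t.trans (by gcongr)

lemma le_of_forall_mul_sub_sq_le {x y D δ : ℝ} (hδ : 0 < δ)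
    (h : ∀ ε, 0 < ε → ε ≤ δ → ε * x - D * ε ^ 2 ≤ ε * y) : x ≤ y := by
  have hlim : Tendsto (fun ε : ℝ => x - D * ε) (𝓝[>] 0) (𝓝 x) := by
    have hcont : Continuous fun ε : ℝ => x - D * ε := by fun_prop
    simpa using (hcont.tendsto 0).mono_left nhdsWithin_le_nhds
  refine le_of_tendsto hlim ?_
  filter_upwards [Ioc_mem_nhdsGT hδ] with ε hε
  exact le_of_mul_le_mul_left (by linarith [h ε hε.1 hε.2]) hε.1

lemma LocallyLipschitzWellPosed.exists_cosh_le {α q r s τ : ℝ} (hα : 0 ≤ α) (hα2 : α ≤ 2)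
    (hαq : α < q) (hq : 1 < q) (h : LocallyLipschitzWellPosed α q r s τ) :
    ∃ T K : ℝ, 0 < T ∧ ∀ n : ℤ, n ≠ 0 →
      Real.cosh (|(n : ℝ)| ^ α / 2 * T) ≤ K * |gevreyWeight r s τ ![n, 0]| := by
  obtain ⟨T, K, hT, hK, hsol⟩ := h.exists_solution_near
    ⟨meanFree_shear, gevreyNorm_mode_lt_top r s τ _ _⟩ (isSolution_shear α q)
  refine ⟨T, 2 * K, hT, fun n hn => ?_⟩
  set G := |gevreyWeight r s τ ![n, 0]|
  refine le_of_forall_mul_sub_sq_le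
    (D := 2 * (2 * K * G) ^ 2 * T * Real.exp (2 * n ^ 2 * T)) (δ := (2 * G + 1)⁻¹)
    (by positivity) fun ε hε hε_le => ?_
  have hsmall : 2 * ε * G ≤ 1 := by
    have := mul_le_mul_of_nonneg_right hε_le (by positivity : 0 ≤ 2 * G + 1)
    rw [inv_mul_cancel₀ (by positivity)] at this
    linarith
  have hnorm : gevreyNorm r s τ (mode (2 * ε : ℝ) ![n, 0]) ≤ ENNReal.ofReal (2 * ε * G) := by
    refine (gevreyNorm_mode_le r s τ _ _).trans_eq ?_
    rw [Complex.norm_real, Real.norm_of_nonneg (by positivity), mul_comm]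
  obtain ⟨θ, hθ, hθ_le⟩ := hsol _ (meanFree_mode _ fun hk => hn (congrFun hk 0))
    (hnorm.trans (ENNReal.ofReal_le_one.mpr hsmall))
  have hM : ∀ t ∈ Icc 0 T, sobolevNorm q (θ t - shear) ≤ (K * (2 * ε * G)).toNNReal := fun t ht =>
    (hθ_le t ht).trans ((mul_le_mul_right hnorm _).trans_eq (ENNReal.ofReal_mul hK.le).symm)
  have hgrowth := hθ.mul_cosh_sub_le hα hα2 hαq hq hT.le hε.le hn hM
  rw [Real.coe_toNNReal _ (by positivity)] at hgrowth
  linarith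

lemma isLittleO_rpow_mul_exp_rpow {a b c : ℝ} (hab : a < b) (hb : 0 < b) (hc : 0 < c) (r τ : ℝ) :
    (fun x : ℝ => x ^ r * Real.exp (τ * x ^ a)) =o[atTop] fun x => Real.exp (c * x ^ b) := by
  have hexponent : (fun x : ℝ => Real.log x * r + τ * x ^ a) =o[atTop] fun x => c * x ^ b :=
    ((((isLittleO_log_rpow_atTop hb).const_mul_left r).congr_left fun x => mul_comm r _).add
      ((isLittleO_rpow_rpow_atTop hab).const_mul_left τ)).const_mul_right hc.ne'
  have heq : (fun x : ℝ => x ^ r * Real.exp (τ * x ^ a))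
      =ᶠ[atTop] fun x => Real.exp (Real.log x * r + τ * x ^ a) := by
    filter_upwards [eventually_gt_atTop 0] with x hx
    rw [Real.exp_add, Real.rpow_def_of_pos hx]
  refine heq.trans_isLittleO (Real.isLittleO_exp_comp_exp_comp.mpr ?_)
  exact (IsEquivalent.refl.sub_isLittleO hexponent).symm.tendsto_atTop
    ((tendsto_rpow_atTop hb).const_mul_atTop hc)

lemma exists_nat_mul_rpow_mul_exp_lt {a b c : ℝ} (hab : a < b) (hb : 0 < b) (hc : 0 < c)
    (A r τ : ℝ) : ∃ n : ℕ, n ≠ 0 ∧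
      A * ((n : ℝ) ^ r * Real.exp (τ * (n : ℝ) ^ a)) < Real.exp (c * (n : ℝ) ^ b) := by
  have hsmall := ((isLittleO_rpow_mul_exp_rpow hab hb hc r τ).const_mul_left A).def one_half_pos
  obtain ⟨n, hn, hn_pos⟩ := ((tendsto_natCast_atTop_atTop.eventually hsmall).and
    (eventually_ne_atTop 0)).exists
  refine ⟨n, hn_pos, (le_abs_self _).trans_lt (hn.trans_lt ?_)⟩
  rw [Real.norm_of_nonneg (Real.exp_pos _).le]
  linarith [Real.exp_pos (c * (n : ℝ) ^ b)]

lemma gevreyWeight_natCast (r s τ : ℝ) {n : ℕ} (hn : n ≠ 0) :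
    gevreyWeight r s τ ![n, 0] = (n : ℝ) ^ r * Real.exp (τ * (n : ℝ) ^ (1 / s)) := by
  have hne : (![n, 0] : Fin 2 → ℤ) ≠ 0 := fun h => hn (Int.natCast_eq_zero.mp (congrFun h 0))
  simp [gevreyWeight, hne, freqNorm]

end SIPM

end

theorem mainTheorem6_general {α q r s τ : ℝ} (hα : 0 < α) (hα2 : α ≤ 2) (hαq : α < q) (hq : 1 < q)
    (hs : 1 / α < s) : SIPM.LocallyLipschitzIllPosed α q r s τ := by
  intro hwell
  obtain ⟨T, K, hT, hcosh⟩ := hwell.exists_cosh_le hα.le hα2 hαq hq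
  have hsα : 1 / s < α := (one_div_lt hα ((one_div_pos.mpr hα).trans hs)).mp hs
  obtain ⟨n, hn, hlt⟩ := SIPM.exists_nat_mul_rpow_mul_exp_lt hsα hα (half_pos hT) (2 * K) r τ
  have hle := hcosh n (Int.natCast_ne_zero.mpr hn)
  rw [SIPM.gevreyWeight_natCast r s τ hn, Int.cast_natCast, Nat.abs_cast,
    abs_of_nonneg (by positivity), Real.cosh_eq, div_mul_comm] at hle
  linarith [Real.exp_pos (-(T / 2 * (n : ℝ) ^ α))]

theorem mainTheorem6 (α q r s τ : ℝ) (hα : 1 ≤ α ∧ α < 2) (hq : α + 1 / 2 < q)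
    (hs : 1 / α < s) (hr : 3 < r) (hτ : 0 < τ) :
    SIPM.LocallyLipschitzIllPosed α q r s τ :=
  mainTheorem6_general (by linarith) hα.2.le (by linarith) (by linarith) hs
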